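/- **Setting.** Let $\Omega$ be a finite set and $\ell\ge 1$. Let $\mathcal P_0,\dots,\mathcal P_\ell$ be reversible ergodic Markov chains on $\Omega$ with transition matrices $P_j$ and stationary distributions $\pi_j$. Put $|\pi\rangle=\sum_x\sqrt{\pi(x)}\,|x\rangle$, $T_j|x\rangle=|x\rangle\sum_y\sqrt{P_j(x,y)}\,|y\rangle$, let $S|x\rangle|y\rangle=|y\rangle|x\rangle$, and let $W_j=(2T_jT_j^\dagger-I)S$ be the qubitized Szegedy walk, with phase gap $\Delta_{W_j}=\min\{|\theta|:\theta\ne0,\ e^{i\theta}\in\mathrm{spec}(W_j)\}$. Let $p_i\in(0,1]$ ($0\le i<\ell$) and $\Delta_j\in(0,2\pi]$ ($0\le j\le\ell$) satisfy $|\langle\pi_i|\pi_{i+1}\rangle|^2\ge p_i$ and $\Delta_{W_j}\ge\Delta_j$; put $p_{\min}=\min_i p_i$ and $\Delta_{\min}=\min_j\Delta_j$. Fix a basis state $|0\rangle$ of the second $\Omega$-register. An oracle for $\mathcal P_j$ is any unitary $O_j$ on two $\Omega$-registers with $O_j|x\rangle|0\rangle=T_j|x\rangle$ for all $x$. A query is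 one use of some $O_j$ or $O_j^\dagger$. The trace distance of pure states is $D_{\rm tr}(|\alpha\rangle,|\beta\rangle)=\sqrt{1-|\langle\alpha|\beta\rangle|^2}$. **Algorithm.** The algorithm is a circuit on one qubit and two $\Omega$-registers. Its gates are single-qubit gates on the qubit, the gates $O_j$ and $O_j^\dagger$, and, controlled on the qubit being $|0\rangle$, the swap $S$ and the reflection $2|0\rangle\langle0|-I$ of the second register. The latter, with one use each of $O_j$ and $O_j^\dagger$, give the controlled walk $W_j$. Given single-qubit gates $R_0,\dots,R_d$, write $C(W_j)=R_d\,(\mathrm{ctrl}\,W_j)\,R_{d-1}\cdots R_1\,(\mathrm{ctrl}\,W_j)\,R_0$ for the resulting generalized quantum signal processing circuit, and $\Upsilon$ for the polynomial with $(\langle0|\otimes I)\,C(W)\,(|0\rangle\otimes I)=\Upsilon(W)$. Let $P_\phi=\mathrm{diag}(e^{i\phi},1)$ on the qubit. The compiled selective phase is $\widehat S_{j,\phi}=O_j^\dagger\,C(W_j)^\dagger P_\phi\, C(W_j)\,O_j$. The data of stage $i$ ($0\le i<\ell$) are errors $\varepsilon_i^{\rm FP},\varepsilon_i^{W}\in(0,1)$,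 phases $(\alpha_k,\beta_k)_{k=1}^{m_i}$, and gates $R$ for the source chain $i$ and for the target chain $i+1$. Put $L_i=2m_i+1$. The data are *admissible* for $(\ell,(p_i),(\Delta_j),\varepsilon)$ if, for every $i$: * $\varepsilon_i^{\rm FP}+2(L_i-1)\varepsilon_i^{W}\le\varepsilon/\ell$; * with $S_\phi(v)=I+(e^{i\phi}-1)|v\rangle\langle v|$, for all unit vectors $s,t$ of a finite-dimensional Hilbert space with $|\langle s|t\rangle|^2\ge p_i$ one has $D_{\rm tr}\big(\prod_{k} S_{\beta_k}(t)S_{\alpha_k}(s)\,|s\rangle,|t\rangle\big)\le\varepsilon_i^{\rm FP}$, the factor $k=1$ being applied first; * for $j\in\{i,i+1\}$ the polynomial $\Upsilon$ of the gates for chain $j$ satisfies $\Upsilon(1)=1$ and $|\Upsilon(e^{i\theta})|\le\varepsilon_i^{W}$ whenever $\Delta_j\le|\theta|\le\pi$. Stage $i$ applies $\widehat S_{i,\alpha_k}$ and then $\widehat S_{i+1,\beta_k}$, for $k=1,\dots,m_i$. The algorithm applies the stages $0,\dots,\ell-1$ in order to the state $|0\rangle|\pi_0\rangle|0\rangle$.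 **Theorem (end-to-end constant-ancilla QSample preparation).** There is a universal constant $C>0$ such that, for all $\ell$, $(p_i)$, $(\Delta_j)$ as above and every $\varepsilon\in(0,1)$: 1. There are admissible data, depending only on $\ell$, $(p_i)$, $(\Delta_j)$ and $\varepsilon$, for which the number of queries made by the algorithm is at most $$C\,\frac{\ell}{\sqrt{p_{\min}}\,\Delta_{\min}}\,\log\frac{\ell}{\varepsilon'}\,\log\!\left(\frac{\ell}{\varepsilon'\sqrt{p_{\min}}}\log\frac{\ell}{\varepsilon'}\right),\qquad \varepsilon'=\min(\varepsilon,\tfrac12).$$ 2. For all admissible data, all $\Omega$, all chains $\mathcal P_0,\dots,\mathcal P_\ell$ on $\Omega$ with the overlap and phase gap bounds $(p_i)$ and $(\Delta_j)$, and all oracles $O_0,\dots,O_\ell$ for them, the algorithm outputs a state within trace distance $\varepsilon$ of $|0\rangle|\pi_\ell\rangle|0\rangle$. In particular the algorithm uses only one qubit beyond the two $\Omega$-registers. -/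

import Mathlib

open scoped Matrix Kronecker

universe u

noncomputable section

namespace QSamplePrep

/-! ### Reversible ergodic Markov chains and their quantum walks -/

/-- `P` is the transition matrix of an ergodic (irreducible and aperiodic, that is, primitive)
Markov chain on the finite set `Ω`, reversible with respect to the probability distribution `π`;
by detailed balance `π` is then the stationary distribution of the chain. -/
structure IsReversibleErgodic {Ω : Type u} [Fintype Ω] [DecidableEq Ω]
    (P : Matrix Ω Ω ℝ) (π : Ω → ℝ) : Prop where
  stochastic : P ∈ Matrix.rowStochastic ℝ Ω
  ergodic : P.IsPrimitive
  nonneg : ∀ x, 0 ≤ π x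
  sum_eq_one : ∑ x, π x = 1
  detailed_balance : ∀ x y, π x * P x y = π y * P y x

/-- The quantum sample `|π⟩ = ∑ₓ √π(x) |x⟩`. -/
def qsample {Ω : Type u} (π : Ω → ℝ) : Ω → ℂ := fun x => ((√(π x) : ℝ) : ℂ)

/-- The quantum step isometry `T : |x⟩ ↦ |x⟩ ∑_y √P(x,y) |y⟩`. -/
def stepIsometry {Ω : Type u} [DecidableEq Ω] (P : Matrix Ω Ω ℝ) : Matrix (Ω × Ω) Ω ℂ :=
  Matrix.of fun z x => if z.1 = x then ((√(P x z.2) : ℝ) : ℂ) else 0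

/-- The swap operator `S : |x⟩|y⟩ ↦ |y⟩|x⟩`. -/
def swapMatrix (Ω : Type u) [DecidableEq Ω] : Matrix (Ω × Ω) (Ω × Ω) ℂ :=
  Matrix.of fun z w => if z = w.swap then 1 else 0

/-- The qubitized Szegedy walk `W = (2 T T† - 1) S`. -/
def walk {Ω : Type u} [Fintype Ω] [DecidableEq Ω] (P : Matrix Ω Ω ℝ) :
    Matrix (Ω × Ω) (Ω × Ω) ℂ :=
  ((2 : ℂ) • (stepIsometry P * (stepIsometry P)ᴴ) - 1) * swapMatrix Ω

/-- The phase gap `min {|θ| : θ ≠ 0, e^{iθ} ∈ spec W}` of the qubitized walk. -/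
def phaseGap {Ω : Type u} [Fintype Ω] [DecidableEq Ω] (P : Matrix Ω Ω ℝ) : ℝ :=
  sInf {r : ℝ | ∃ θ : ℝ, θ ≠ 0 ∧ Complex.exp (θ * Complex.I) ∈ spectrum ℂ (walk P) ∧ r = |θ|}

/-- `O` is an oracle for the chain `P`, with reference state `|o⟩` in the second register (the
state written `|0⟩`): a unitary with `O |x⟩|o⟩ = ∑_y √P(x,y) |x⟩|y⟩`. Nothing is assumed about the
action of `O` on the other basis states. -/
def IsOracle {Ω : Type u} [Fintype Ω] [DecidableEq Ω] (P : Matrix Ω Ω ℝ) (o : Ω)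
    (O : Matrix.unitaryGroup (Ω × Ω) ℂ) : Prop :=
  ∀ x z, (O : Matrix (Ω × Ω) (Ω × Ω) ℂ) z (x, o) = stepIsometry P z x

/-- Trace distance of the pure states given by the unit vectors `v` and `w`. -/
def traceDist {ι : Type u} [Fintype ι] (v w : ι → ℂ) : ℝ := √(1 - ‖star v ⬝ᵥ w‖ ^ 2)

/-! ### Circuits on one qubit and two `Ω`-registers -/

/-- The single-qubit unitaries. -/
abbrev QubitGate := Matrix.unitaryGroup (Fin 2) ℂ

/-- The gates of a circuit which acts on one qubit and two `Ω`-registers, and which has access to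
the oracles `O₀, …, O_ℓ`. -/
inductive Gate (ℓ : ℕ) where
  /-- `O_j` on the two `Ω`-registers -/
  | query (j : Fin (ℓ + 1))
  /-- `O_j†` on the two `Ω`-registers -/
  | queryAdj (j : Fin (ℓ + 1))
  /-- a single-qubit unitary on the qubit -/
  | qubit (R : QubitGate)
  /-- the swap of the two `Ω`-registers, controlled on the qubit being `|0⟩` -/
  | ctrlSwap
  /-- the reflection `2|o⟩⟨o| - 1` of the second `Ω`-register, controlled on the qubit being
  `|0⟩` -/
  | ctrlReflect

/-- A circuit: a list of gates, the first one being applied first. -/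
abbrev Circuit (ℓ : ℕ) := List (Gate ℓ)

/-- `|0⟩⟨0| ⊗ U + |1⟩⟨1| ⊗ 1`. -/
def ctrlZero {κ : Type u} [DecidableEq κ] (U : Matrix κ κ ℂ) : Matrix (Fin 2 × κ) (Fin 2 × κ) ℂ :=
  Matrix.single (0 : Fin 2) (0 : Fin 2) (1 : ℂ) ⊗ₖ U +
    Matrix.single (1 : Fin 2) (1 : Fin 2) (1 : ℂ) ⊗ₖ (1 : Matrix κ κ ℂ)

/-- The unitary of a gate, for the oracles `O` and the reference state `|o⟩`. -/
def Gate.toMatrix {ℓ : ℕ} {Ω : Type u} [Fintype Ω] [DecidableEq Ω]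
    (O : Fin (ℓ + 1) → Matrix.unitaryGroup (Ω × Ω) ℂ) (o : Ω) :
    Gate ℓ → Matrix (Fin 2 × Ω × Ω) (Fin 2 × Ω × Ω) ℂ
  | .query j => (1 : Matrix (Fin 2) (Fin 2) ℂ) ⊗ₖ (O j : Matrix (Ω × Ω) (Ω × Ω) ℂ)
  | .queryAdj j => (1 : Matrix (Fin 2) (Fin 2) ℂ) ⊗ₖ (O j : Matrix (Ω × Ω) (Ω × Ω) ℂ)ᴴ
  | .qubit R => (R : Matrix (Fin 2) (Fin 2) ℂ) ⊗ₖ (1 : Matrix (Ω × Ω) (Ω × Ω) ℂ)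
  | .ctrlSwap => ctrlZero (swapMatrix Ω)
  | .ctrlReflect => ctrlZero ((1 : Matrix Ω Ω ℂ) ⊗ₖ ((2 : ℂ) • Matrix.single o o (1 : ℂ) - 1))

/-- The inverse gate. -/
def Gate.inv {ℓ : ℕ} : Gate ℓ → Gate ℓ
  | .query j => .queryAdj j
  | .queryAdj j => .query j
  | .qubit R => .qubit R⁻¹
  | .ctrlSwap => .ctrlSwap
  | .ctrlReflect => .ctrlReflect

/-- The number of oracle queries made by a gate: one for each use of `O_j` or `O_j†`. -/
def Gate.queries {ℓ : ℕ} : Gate ℓ → ℕ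
  | .query _ => 1
  | .queryAdj _ => 1
  | .qubit _ => 0
  | .ctrlSwap => 0
  | .ctrlReflect => 0

/-- The adjoint circuit: the inverse gates in reversed order. -/
def Circuit.adjoint {ℓ : ℕ} (c : Circuit ℓ) : Circuit ℓ := (List.map Gate.inv c).reverse

/-- The total number of oracle queries of a circuit. -/
def Circuit.queries {ℓ : ℕ} (c : Circuit ℓ) : ℕ := (List.map Gate.queries c).sum

/-- The result of running a circuit on the state `ψ`. -/
def Circuit.run {ℓ : ℕ} {Ω : Type u} [Fintype Ω] [DecidableEq Ω]
    (O : Fin (ℓ + 1) → Matrix.unitaryGroup (Ω × Ω) ℂ) (o : Ω) (c : Circuit ℓ)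
    (ψ : Fin 2 × Ω × Ω → ℂ) : Fin 2 × Ω × Ω → ℂ :=
  List.foldl (fun φ g => g.toMatrix O o *ᵥ φ) ψ c

/-- The joint clean state `|0⟩ ⊗ |π⟩ ⊗ |o⟩`. -/
def cleanState {Ω : Type u} [DecidableEq Ω] (π : Ω → ℝ) (o : Ω) : Fin 2 × Ω × Ω → ℂ :=
  fun z => if z.1 = 0 ∧ z.2.2 = o then qsample π z.2.1 else 0

/-- The walk `W_j = O_j (1 ⊗ (2|o⟩⟨o| - 1)) O_j† S`, controlled on the qubit being `|0⟩`. When the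
qubit is `|1⟩`, the uncontrolled `O_j†` and `O_j` cancel. -/
def ctrlWalk {ℓ : ℕ} (j : Fin (ℓ + 1)) : Circuit ℓ :=
  [.ctrlSwap, .queryAdj j, .ctrlReflect, .query j]

/-! ### Generalized quantum signal processing and the selective phase compiler -/

/-- The single-qubit unitaries `R₀, R₁, …, R_d` of a GQSP circuit (`rest = [R₁, …, R_d]`). -/
structure GQSP where
  first : QubitGate
  rest : List QubitGate

/-- The GQSP circuit `C(W_j) = R_d (ctrl W_j) R_{d-1} ⋯ R₁ (ctrl W_j) R₀`. -/
def GQSP.circuit {ℓ : ℕ} (G : GQSP) (j : Fin (ℓ + 1)) : Circuit ℓ :=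
  Gate.qubit G.first :: G.rest.flatMap fun R => ctrlWalk j ++ [Gate.qubit R]

/-- The GQSP circuit as a matrix of polynomials in the signal unitary: its first column consists
of the polynomials `Υ`, `Φ` of degree at most `d` with
`C(W) (|0⟩ ⊗ 1) = |0⟩ ⊗ Υ(W) + |1⟩ ⊗ Φ(W)`. -/
def GQSP.polyMatrix (G : GQSP) : Matrix (Fin 2) (Fin 2) (Polynomial ℂ) :=
  List.foldl
    (fun M R => (R : Matrix (Fin 2) (Fin 2) ℂ).map Polynomial.C *
      Matrix.diagonal ![Polynomial.X, 1] * M)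
    ((G.first : Matrix (Fin 2) (Fin 2) ℂ).map Polynomial.C) G.rest

/-- The polynomial `Υ` implemented by the GQSP circuit. -/
def GQSP.polynomial (G : GQSP) : Polynomial ℂ := G.polyMatrix 0 0

/-- The GQSP circuit filters the eigenvalue `1` of a unitary of phase gap at least `Δ`, with
error `ε`: `Υ(1) = 1`, and `|Υ(e^{iθ})| ≤ ε` whenever `Δ ≤ |θ| ≤ π`. -/
def GQSP.IsProjector (G : GQSP) (Δ ε : ℝ) : Prop :=
  G.polynomial.eval 1 = 1 ∧
    ∀ θ : ℝ, Δ ≤ |θ| → |θ| ≤ Real.pi → ‖G.polynomial.eval (Complex.exp (θ * Complex.I))‖ ≤ ε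

/-- The phase gate `P_φ = e^{iφ}|0⟩⟨0| + |1⟩⟨1|`. -/
def phaseGate (φ : ℝ) : QubitGate :=
  ⟨Matrix.diagonal ![Complex.exp (φ * Complex.I), 1], by
    rw [Matrix.mem_unitaryGroup_iff, Matrix.star_eq_conjTranspose, Matrix.diagonal_conjTranspose,
      Matrix.diagonal_mul_diagonal, ← Matrix.diagonal_one]
    congr 1
    funext i
    fin_cases i <;> simp [← Complex.exp_conj, ← Complex.exp_add]⟩

/-- The compiled selective phase of the chain `j`: the circuit `C(W_j)† (P_φ ⊗ 1) C(W_j)`,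
conjugated by `O_j`, which carries `|x⟩|o⟩` to `T_j |x⟩`. -/
def selectivePhaseCircuit {ℓ : ℕ} (G : GQSP) (j : Fin (ℓ + 1)) (φ : ℝ) : Circuit ℓ :=
  [Gate.query j] ++
    (G.circuit j ++ [Gate.qubit (phaseGate φ)] ++ Circuit.adjoint (G.circuit j)) ++
    [Gate.queryAdj j]

/-! ### Fixed-point amplitude amplification -/

/-- The ideal selective phase operator `1 + (e^{iφ} - 1)|v⟩⟨v|`. -/
def selectivePhase {ι : Type u} [DecidableEq ι] (v : ι → ℂ) (φ : ℝ) : Matrix ι ι ℂ :=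
  1 + (Complex.exp (φ * Complex.I) - 1) • Matrix.vecMulVec v (star v)

/-- The ideal amplification operator with source `s`, target `t` and phases
`[(α₁, β₁), …, (α_m, β_m)]`: the product of the operators
`selectivePhase t β_k * selectivePhase s α_k`, the one for `k = 1` being applied first. -/
def amplifier {ι : Type u} [Fintype ι] [DecidableEq ι] (phases : List (ℝ × ℝ)) (s t : ι → ℂ) :
    Matrix ι ι ℂ :=
  List.foldl (fun U a => selectivePhase t a.2 * selectivePhase s a.1 * U) 1 phases

/-- The phases drive every unit vector `s` to within trace distance `δ` of every unit vector `t`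
whose squared overlap with `s` is at least `p`. -/
def IsFixedPoint (p δ : ℝ) (phases : List (ℝ × ℝ)) : Prop :=
  ∀ (ι : Type u) [Fintype ι] [DecidableEq ι] (s t : ι → ℂ),
    star s ⬝ᵥ s = 1 → star t ⬝ᵥ t = 1 → p ≤ ‖star s ⬝ᵥ t‖ ^ 2 →
      traceDist (amplifier phases s t *ᵥ s) t ≤ δ

/-! ### The preparation algorithm -/

/-- The classical data of one stage of the algorithm, which moves the QSample of one chain (the
source) to that of the next one (the target). -/
structure Stage where
  /-- the amplification phases `[(α₁, β₁), …, (α_m, β_m)]` -/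
  phases : List (ℝ × ℝ)
  /-- the GQSP circuit used for the source -/
  source : GQSP
  /-- the GQSP circuit used for the target -/
  target : GQSP
  /-- the error allowed to the ideal amplification -/
  εFP : ℝ
  /-- the error allowed to the GQSP projectors -/
  εW : ℝ

/-- The length `L = 2m + 1` of the amplification sequence. -/
def Stage.L (A : Stage) : ℕ := 2 * A.phases.length + 1

/-- The circuit of stage `i`: for `k = 1, …, m`, the compiled selective phase of the chain `i` with
phase `α_k`, followed by that of the chain `i + 1` with phase `β_k`. -/
def Stage.circuit {ℓ : ℕ} (A : Stage) (i : Fin ℓ) : Circuit ℓ :=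
  A.phases.flatMap fun a =>
    selectivePhaseCircuit A.source i.castSucc a.1 ++ selectivePhaseCircuit A.target i.succ a.2

/-- The data of stage `i` of an `ℓ`-stage run with total error `ε` are admissible, for the overlap
bound `p` and the phase gap bounds `Δs` (source) and `Δt` (target). -/
structure Stage.IsAdmissible (A : Stage) (ℓ : ℕ) (p Δs Δt ε : ℝ) : Prop where
  εFP_mem : A.εFP ∈ Set.Ioo (0 : ℝ) 1
  εW_mem : A.εW ∈ Set.Ioo (0 : ℝ) 1
  error_le : A.εFP + 2 * ((A.L : ℝ) - 1) * A.εW ≤ ε / ℓ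
  fixedPoint : IsFixedPoint.{u} p A.εFP A.phases
  source_projector : A.source.IsProjector Δs A.εW
  target_projector : A.target.IsProjector Δt A.εW

/-- The QSample preparation algorithm with stages `A₀, …, A_{ℓ-1}`. -/
def algorithm {ℓ : ℕ} (A : Fin ℓ → Stage) : Circuit ℓ :=
  (List.finRange ℓ).flatMap fun i => (A i).circuit i

/-- The data of all stages are admissible, for the overlap bounds `p_i`, the phase gap bounds `Δ_j`
and the total error `ε`. They do not depend on the chains in any other way. -/
def IsAdmissible {ℓ : ℕ} (A : Fin ℓ → Stage) (p : Fin ℓ → ℝ) (Δ : Fin (ℓ + 1) → ℝ) (ε : ℝ) :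
    Prop :=
  ∀ i, Stage.IsAdmissible.{u} (A i) ℓ (p i) (Δ i.castSucc) (Δ i.succ) ε

/-- `ℓ / (√p Δ) · log (ℓ/ε) · log ((ℓ / (ε √p)) log (ℓ/ε))`. -/
def queryBound (ℓ : ℕ) (p Δ ε : ℝ) : ℝ :=
  ℓ / (√p * Δ) * Real.log (ℓ / ε) * Real.log (ℓ / (ε * √p) * Real.log (ℓ / ε))

end QSamplePrep

end

noncomputable section

namespace QSamplePrep

/-! ### Vectors as elements of a Euclidean space -/

section Euclidean

variable {ι : Type*} [Fintype ι]

/-! One cubic recursion drives both amplification and filtering. A step of either replaces a failure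
quantity `q` by `q (1 - κ (1 - q))²` with `κ = 2 - 2 cos γ`. Since `T₃(cosh a) = cosh 3a` for the
Chebyshev polynomial `T₃`, a suitable `γ` turns the invariant `cosh(a)² q ≤ 1` into `cosh(3a)² q' ≤
1` (`exists_angle`). After `n` nestings `q` is at most `1 / cosh(3ⁿa)²`, at length `3ⁿ`, so `3ⁿ ≈
log(1/δ)/a` suffices for `q ≤ δ²`.

For amplification `q` is one minus the squared overlap and `a = √p` (`exists_isFixedPoint`). For
filtering `q = |Υ(z)|²`, the base circuit has `Υ(z) = (1 + z)/2`, and `a = Δ/π` by Jordan's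
inequality (`exists_isProjector`); every step keeps `Υ(1) = 1` exactly. Using the data for the
smallest `p` and `Δ` in all stages gives the query bound.

For correctness, detailed balance and primitivity imply that `T†` maps each fixed vector of the walk
to a multiple of `|π⟩` (`IsReversibleErgodic.exists_eq_smul_qsample`). Hence `Tχ` is orthogonal to
the whole fixed space when `χ ⊥ |π⟩`, and `Υ(W)` shrinks it to norm at most `ε ‖χ‖`
(`GQSP.IsProjector.norm_aeval_walk_le`). On `T|π⟩` the circuit `C(W)` acts trivially with the qubit
in `|0⟩`, so a compiled phase is within `2ε` of the ideal one on clean states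
(`norm_run_selectivePhaseCircuit_sub_le`). Unitarity makes these errors additive within a stage, and
the triangle inequality for the trace distance adds the stages. -/

lemma star_dotProduct_eq_inner (v w : ι → ℂ) :
    star v ⬝ᵥ w = inner ℂ (WithLp.toLp 2 v) (WithLp.toLp 2 w) := by
  rw [EuclideanSpace.inner_toLp_toLp, dotProduct_comm]

lemma norm_toLp_eq_one_iff (v : ι → ℂ) : ‖WithLp.toLp 2 v‖ = 1 ↔ star v ⬝ᵥ v = 1 := by
  rw [star_dotProduct_eq_inner, inner_self_eq_norm_sq_to_K]
  refine ⟨fun h => by simp [h], fun h => ?_⟩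
  exact (pow_eq_one_iff_of_nonneg (norm_nonneg _) two_ne_zero).1
    (Complex.ofReal_injective (by simpa using h))

lemma norm_star_dotProduct_le_one {v w : ι → ℂ} (hv : star v ⬝ᵥ v = 1) (hw : star w ⬝ᵥ w = 1) :
    ‖star v ⬝ᵥ w‖ ≤ 1 := by
  rw [← norm_toLp_eq_one_iff] at hv hw
  rw [star_dotProduct_eq_inner]
  simpa [hv, hw] using norm_inner_le_norm (𝕜 := ℂ) (WithLp.toLp 2 v) (WithLp.toLp 2 w)

end Euclidean

/-! ### The cubic recursion of nested amplification -/

/-- One amplification step replaces the failure probability `q` by `q * (1 - κ * (1 - q)) ^ 2`,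
where `κ = 2 - 2 * cos γ`. A suitable `γ` makes this the Chebyshev polynomial of degree three. -/
lemma exists_angle_cube {y : ℝ} (hy : 1 ≤ y) :
    ∃ γ : ℝ, ∀ q : ℝ, 0 ≤ q → y ^ 2 * q ≤ 1 →
      (4 * y ^ 3 - 3 * y) ^ 2 * (q * (1 - (2 - 2 * Real.cos γ) * (1 - q)) ^ 2) ≤ 1 := by
  have hD : 0 < 4 * y ^ 2 - 3 := by nlinarith
  -- This `γ` gives `κ = 4y²/(4y² - 3)`, chosen so that `(4y² - 3)(1 - κ(1 - q)) = 4y²q - 3`. The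
  -- arccosine is legitimate because `y ≥ 1`.
  refine ⟨Real.arccos (1 - 2 * y ^ 2 / (4 * y ^ 2 - 3)), fun q hq h => ?_⟩
  have h1 : 2 * y ^ 2 / (4 * y ^ 2 - 3) ≤ 2 := by rw [div_le_iff₀ hD]; nlinarith
  have h0 : 0 ≤ 2 * y ^ 2 / (4 * y ^ 2 - 3) := by positivity
  rw [Real.cos_arccos (by linarith) (by linarith)]
  set w := y ^ 2 * q with hw
  have hw0 : 0 ≤ w := by positivity
  have key : (4 * y ^ 3 - 3 * y) ^ 2 *
      (q * (1 - (2 - 2 * (1 - 2 * y ^ 2 / (4 * y ^ 2 - 3))) * (1 - q)) ^ 2) =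
      w * (4 * w - 3) ^ 2 := by
    have e : (4 * y ^ 2 - 3) * (1 - (2 - 2 * (1 - 2 * y ^ 2 / (4 * y ^ 2 - 3))) * (1 - q)) =
        4 * w - 3 := by
      rw [hw]; field_simp; ring
    calc _ = w * ((4 * y ^ 2 - 3) *
          (1 - (2 - 2 * (1 - 2 * y ^ 2 / (4 * y ^ 2 - 3))) * (1 - q))) ^ 2 := by rw [hw]; ring
      _ = _ := by rw [e]
  rw [key]
  -- This is `1 - T₃(x)² = (1 - x²) U₂(x)²` at `x = √w`.
  have : 1 - w * (4 * w - 3) ^ 2 = (1 - w) * (4 * w - 1) ^ 2 := by ring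
  nlinarith [mul_nonneg (sub_nonneg.2 h) (sq_nonneg (4 * w - 1))]

lemma exists_angle (a : ℝ) :
    ∃ γ : ℝ, ∀ q : ℝ, 0 ≤ q → Real.cosh a ^ 2 * q ≤ 1 →
      Real.cosh (3 * a) ^ 2 * (q * (1 - (2 - 2 * Real.cos γ) * (1 - q)) ^ 2) ≤ 1 := by
  obtain ⟨γ, hγ⟩ := exists_angle_cube (Real.one_le_cosh a)
  exact ⟨γ, fun q hq h => by rw [Real.cosh_three_mul]; exact hγ q hq h⟩

/-- Starts the recursion: `cosh(a)² ≤ exp(a²) ≤ exp(1 - q)`, while `q ≤ exp(-(1 - q))`. -/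
lemma cosh_sq_mul_le_one {a q : ℝ} (h : a ^ 2 ≤ 1 - q) : Real.cosh a ^ 2 * q ≤ 1 := by
  rcases le_or_gt q 0 with hq | hq
  · nlinarith [sq_nonneg (Real.cosh a)]
  have h1 : Real.cosh a ^ 2 ≤ Real.exp (1 - q) := by
    calc Real.cosh a ^ 2 ≤ Real.exp (a ^ 2 / 2) ^ 2 :=
          pow_le_pow_left₀ (Real.cosh_pos a).le (Real.cosh_le_exp_half_sq a) 2
      _ = Real.exp (a ^ 2) := by rw [← Real.exp_nat_mul]; congr 1; push_cast; ring
      _ ≤ _ := Real.exp_le_exp.2 h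
  have h2 : q ≤ Real.exp (-(1 - q)) := by
    have := Real.add_one_le_exp (-(1 - q)); linarith
  calc Real.cosh a ^ 2 * q ≤ Real.exp (1 - q) * Real.exp (-(1 - q)) := by gcongr
    _ = 1 := by rw [← Real.exp_add]; simp

/-- Ends the recursion: `cosh b ≥ e^b / 2 ≥ 1/δ`. -/
lemma le_sq_of_cosh_sq_mul_le {b x δ : ℝ} (hδ : 0 < δ) (hb : Real.log (2 / δ) ≤ b)
    (h : Real.cosh b ^ 2 * x ≤ 1) : x ≤ δ ^ 2 := by
  have h1 : 1 / δ ≤ Real.cosh b := by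
    have h2 : 2 / δ ≤ Real.exp b := (Real.log_le_iff_le_exp (by positivity)).1 hb
    rw [Real.cosh_eq]
    have := Real.exp_pos (-b)
    have e : 2 / δ = 2 * (1 / δ) := by ring
    linarith
  have h3 : (1 / δ) ^ 2 ≤ Real.cosh b ^ 2 := pow_le_pow_left₀ (by positivity) h1 2
  rcases le_or_gt x 0 with hx | hx
  · exact hx.trans (by positivity)
  have h4 : (1 / δ) ^ 2 * x ≤ 1 := (by gcongr : _ ≤ Real.cosh b ^ 2 * x).trans h
  rw [one_div, inv_pow, inv_mul_le_iff₀ (by positivity)] at h4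
  linarith

/-- Nesting only offers lengths `3ⁿ`; rounding up costs a factor three, and the summand `1` covers
`n = 0`. -/
lemma exists_three_pow {r : ℝ} (hr : 0 ≤ r) : ∃ n : ℕ, r ≤ 3 ^ n ∧ (3 : ℝ) ^ n ≤ 3 * r + 1 := by
  rcases le_or_gt r 1 with h | h
  · exact ⟨0, by simpa using h, by simpa using hr⟩
  · obtain ⟨n, h1, h2⟩ := exists_nat_pow_near h.le (by norm_num : (1 : ℝ) < 3)
    exact ⟨n + 1, h2.le, by rw [pow_succ]; linarith⟩

/-! ### Fixed-point amplification by nesting -/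

section Selective

variable {ι : Type u} [DecidableEq ι]

lemma selectivePhase_zero (v : ι → ℂ) : selectivePhase v 0 = 1 := by
  simp [selectivePhase]

lemma conjTranspose_selectivePhase (v : ι → ℂ) (φ : ℝ) :
    (selectivePhase v φ)ᴴ = selectivePhase v (-φ) := by
  simp [selectivePhase, Matrix.conjTranspose_smul, Matrix.conjTranspose_vecMulVec,
    ← Complex.exp_conj]

variable [Fintype ι]

lemma selectivePhase_mulVec (v w : ι → ℂ) (φ : ℝ) :
    selectivePhase v φ *ᵥ w =
      w + ((Complex.exp (φ * Complex.I) - 1) * (star v ⬝ᵥ w)) • v := by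
  rw [selectivePhase, Matrix.add_mulVec, Matrix.one_mulVec, Matrix.smul_mulVec,
    Matrix.vecMulVec_mulVec]
  simp [mul_smul]

lemma selectivePhase_mul_neg {v : ι → ℂ} (hv : star v ⬝ᵥ v = 1) (φ : ℝ) :
    selectivePhase v φ * selectivePhase v (-φ) = 1 := by
  have h : Complex.exp (φ * Complex.I) * Complex.exp ((-φ : ℝ) * Complex.I) = 1 := by
    rw [← Complex.exp_add]; simp
  have h2 : Matrix.vecMulVec v (star v) * Matrix.vecMulVec v (star v) =
      Matrix.vecMulVec v (star v) := by
    rw [Matrix.vecMulVec_mul_vecMulVec, hv]; simp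
  simp only [selectivePhase, add_mul, mul_add, one_mul, mul_one, smul_mul_assoc, mul_smul_comm, h2]
  calc _ = 1 + (Complex.exp (φ * Complex.I) * Complex.exp ((-φ : ℝ) * Complex.I) - 1) •
          Matrix.vecMulVec v (star v) := by module
    _ = 1 := by rw [h]; simp

lemma selectivePhase_mem_unitary {v : ι → ℂ} (hv : star v ⬝ᵥ v = 1) (φ : ℝ) :
    selectivePhase v φ ∈ Matrix.unitaryGroup ι ℂ := by
  rw [Matrix.mem_unitaryGroup_iff, Matrix.star_eq_conjTranspose, conjTranspose_selectivePhase,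
    selectivePhase_mul_neg hv]

lemma star_dotProduct_mulVec_self {A : Matrix ι ι ℂ} (hA : A ∈ Matrix.unitaryGroup ι ℂ)
    (v w : ι → ℂ) : star (A *ᵥ v) ⬝ᵥ (A *ᵥ w) = star v ⬝ᵥ w := by
  rw [Matrix.star_mulVec, ← Matrix.dotProduct_mulVec, Matrix.mulVec_mulVec,
    ← Matrix.star_eq_conjTranspose, Matrix.mem_unitaryGroup_iff'.1 hA, Matrix.one_mulVec]

lemma mul_selectivePhase_mul_conjTranspose {A : Matrix ι ι ℂ}
    (hA : A ∈ Matrix.unitaryGroup ι ℂ) (v : ι → ℂ) (φ : ℝ) :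
    A * selectivePhase v φ * Aᴴ = selectivePhase (A *ᵥ v) φ := by
  rw [selectivePhase, selectivePhase, mul_add, add_mul, mul_one, ← Matrix.star_eq_conjTranspose,
    Matrix.mem_unitaryGroup_iff.1 hA, Matrix.star_mulVec, Matrix.mul_smul, Matrix.smul_mul,
    Matrix.mul_vecMulVec, Matrix.vecMulVec_mul, Matrix.star_eq_conjTranspose]

lemma foldl_amplifier (L : List (ℝ × ℝ)) (s t : ι → ℂ) (U : Matrix ι ι ℂ) :
    List.foldl (fun U a => selectivePhase t a.2 * selectivePhase s a.1 * U) U L =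
      amplifier L s t * U := by
  induction L generalizing U with
  | nil => simp [amplifier]
  | cons a L ih =>
    rw [amplifier, List.foldl_cons, List.foldl_cons, ih, ih]
    simp [mul_assoc]

lemma amplifier_append (L M : List (ℝ × ℝ)) (s t : ι → ℂ) :
    amplifier (L ++ M) s t = amplifier M s t * amplifier L s t := by
  conv_lhs => rw [amplifier, List.foldl_append, foldl_amplifier]
  rfl

lemma amplifier_cons (a : ℝ × ℝ) (L : List (ℝ × ℝ)) (s t : ι → ℂ) :
    amplifier (a :: L) s t =
      amplifier L s t * (selectivePhase t a.2 * selectivePhase s a.1) := by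
  conv_lhs => rw [amplifier, List.foldl_cons, foldl_amplifier]
  rw [mul_one]

lemma amplifier_mem_unitary (L : List (ℝ × ℝ)) {s t : ι → ℂ} (hs : star s ⬝ᵥ s = 1)
    (ht : star t ⬝ᵥ t = 1) : amplifier L s t ∈ Matrix.unitaryGroup ι ℂ := by
  induction L with
  | nil => exact one_mem _
  | cons a L ih =>
    rw [amplifier_cons]
    exact mul_mem ih (mul_mem (selectivePhase_mem_unitary ht _) (selectivePhase_mem_unitary hs _))

/-- Taking adjoints reverses the order inside each source-target pair as well, which a phase list
cannot express in general. If one phase of every pair vanishes, there is no order inside a pair, so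
inverses are again phase lists and nesting is possible. -/
lemma amplifier_reverse_neg {L : List (ℝ × ℝ)} (hL : ∀ a ∈ L, a.1 = 0 ∨ a.2 = 0) (s t : ι → ℂ) :
    amplifier (L.map fun a => -a).reverse s t = (amplifier L s t)ᴴ := by
  induction L with
  | nil => simp [amplifier]
  | cons a L ih =>
    rw [List.map_cons, List.reverse_cons, amplifier_append, amplifier_cons,
      ih fun b hb => hL b (List.mem_cons_of_mem _ hb), amplifier_cons, Matrix.conjTranspose_mul,
      Matrix.conjTranspose_mul, conjTranspose_selectivePhase, conjTranspose_selectivePhase]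
    congr 1
    rcases hL a List.mem_cons_self with h | h <;> simp [h, amplifier, selectivePhase_zero]

/-- With `l` the squared overlap before a step, the left side is the success probability after it;
this form exhibits the failure probability of the cubic recursion. -/
lemma cos_sub_exp_identity (γ l : ℝ) :
    l * ‖2 * Complex.exp (γ * Complex.I) - 1 + (Complex.exp (γ * Complex.I) - 1) ^ 2 * l‖ ^ 2 =
      1 - (1 - l) * (1 - (2 - 2 * Real.cos γ) * l) ^ 2 := by
  rw [← Complex.normSq_eq_norm_sq, Complex.exp_mul_I, ← Complex.ofReal_cos, ← Complex.ofReal_sin,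
    Complex.normSq_apply]
  simp only [pow_two, Complex.add_re, Complex.sub_re, Complex.mul_re, Complex.add_im,
    Complex.sub_im, Complex.mul_im, Complex.ofReal_re, Complex.ofReal_im, Complex.I_re,
    Complex.I_im, Complex.one_re, Complex.one_im, Complex.re_ofNat, Complex.im_ofNat]
  have h : Real.sin γ ^ 2 = 1 - Real.cos γ ^ 2 := by
    rw [Real.sin_sq]
  ring_nf
  simp only [show Real.sin γ ^ 4 = (Real.sin γ ^ 2) ^ 2 by ring, h]
  ring

lemma failure_amplification_step {s t : ι → ℂ} (hs : star s ⬝ᵥ s = 1) (ht : star t ⬝ᵥ t = 1)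
    (γ : ℝ) :
    1 - ‖star ((selectivePhase s γ * selectivePhase t γ) *ᵥ s) ⬝ᵥ t‖ ^ 2 =
      (1 - ‖star s ⬝ᵥ t‖ ^ 2) *
        (1 - (2 - 2 * Real.cos γ) * ‖star s ⬝ᵥ t‖ ^ 2) ^ 2 := by
  have hc : star t ⬝ᵥ s = star (star s ⬝ᵥ t) := by
    rw [Matrix.star_dotProduct]
  have hn : ∀ v : ι → ℂ, ‖star v ⬝ᵥ t‖ = ‖star t ⬝ᵥ v‖ := fun v => by
    rw [Matrix.star_dotProduct, norm_star]
  set c := star t ⬝ᵥ s with hcdef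
  have hc' : star s ⬝ᵥ t = star c := by rw [hc, star_star]
  have hcc : star c * c = ((‖c‖ ^ 2 : ℝ) : ℂ) := by
    rw [Complex.star_def, ← Complex.normSq_eq_conj_mul_self, Complex.normSq_eq_norm_sq]
  rw [hn, hn s, ← Matrix.mulVec_mulVec, selectivePhase_mulVec t, selectivePhase_mulVec s]
  set ω := Complex.exp (γ * Complex.I) - 1 with hω
  simp only [dotProduct_add, dotProduct_smul, hs, ht, ← hcdef, hc', smul_eq_mul]
  have e : c + ω * c * 1 + ω * (1 + ω * c * star c) * c =
      c * (2 * Complex.exp (γ * Complex.I) - 1 +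
        (Complex.exp (γ * Complex.I) - 1) ^ 2 * ((‖c‖ ^ 2 : ℝ) : ℂ)) := by
    rw [← hcc, ← hω]
    have : Complex.exp (γ * Complex.I) = ω + 1 := by rw [hω]; ring
    rw [this]; ring
  rw [e, norm_mul, mul_pow, cos_sub_exp_identity]
  ring

end Selective

/-- The list is built by recursion on `n` from `a` alone, before any space or vectors are chosen, so
one list serves all dimensions. -/
theorem exists_amplification_phases (a : ℝ) (n : ℕ) :
    ∃ L : List (ℝ × ℝ), L.length + 1 = 3 ^ n ∧ (∀ b ∈ L, b.1 = 0 ∨ b.2 = 0) ∧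
      ∀ (ι : Type u) [Fintype ι] [DecidableEq ι] (s t : ι → ℂ),
        star s ⬝ᵥ s = 1 → star t ⬝ᵥ t = 1 →
        Real.cosh a ^ 2 * (1 - ‖star s ⬝ᵥ t‖ ^ 2) ≤ 1 →
        Real.cosh (3 ^ n * a) ^ 2 * (1 - ‖star (amplifier L s t *ᵥ s) ⬝ᵥ t‖ ^ 2) ≤ 1 := by
  induction n with
  | zero => exact ⟨[], by simp, by simp, fun ι _ _ s t _ _ h => by simpa [amplifier] using h⟩
  | succ n ih =>
    obtain ⟨L, hlen, hL, h⟩ := ih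
    obtain ⟨γ, hγ⟩ := exists_angle (3 ^ n * a)
    -- As operators, later factors on the left, this is `A S_s(γ) A† S_t(γ) A = S_{As}(γ) S_t(γ) A`:
    -- one amplification step with the current state `As` as source. The length `3|L| + 2` keeps
    -- `|L| + 1` a power of three.
    refine ⟨L ++ [(0, γ)] ++ (L.map fun a => -a).reverse ++ [(γ, 0)] ++ L, ?_, ?_, ?_⟩
    · simp only [List.length_append, List.length_cons, List.length_nil, List.length_reverse,
        List.length_map, pow_succ]
      omega
    · intro b hb
      simp only [List.mem_append, List.mem_singleton, List.mem_reverse, List.mem_map] at hb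
      rcases hb with (((hb | rfl) | ⟨c, hc, rfl⟩) | rfl) | hb
      · exact hL b hb
      · simp
      · simpa using hL c hc
      · simp
      · exact hL b hb
    · intro ι _ _ s t hs ht h0
      have hU := amplifier_mem_unitary L hs ht
      set A := amplifier L s t with hA
      have hA' : amplifier (L ++ [(0, γ)] ++ (L.map fun a => -a).reverse ++ [(γ, 0)] ++ L) s t *ᵥ s
          = (selectivePhase (A *ᵥ s) γ * selectivePhase t γ) *ᵥ (A *ᵥ s) := by
        simp only [amplifier_append, amplifier_reverse_neg hL, ← hA]
        have e1 : amplifier [(0, γ)] s t = selectivePhase t γ := by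
          simp [amplifier, selectivePhase_zero]
        have e2 : amplifier [(γ, 0)] s t = selectivePhase s γ := by
          simp [amplifier, selectivePhase_zero]
        rw [e1, e2, ← mul_selectivePhase_mul_conjTranspose hU, Matrix.mulVec_mulVec]
        simp only [mul_assoc]
      have hs' : star (A *ᵥ s) ⬝ᵥ (A *ᵥ s) = 1 := by rw [star_dotProduct_mulVec_self hU, hs]
      rw [hA', failure_amplification_step hs' ht, pow_succ (3 : ℝ) n, mul_comm (3 ^ n : ℝ) 3,
        mul_assoc (3 : ℝ)]
      have hq := h ι s t hs ht h0
      set q := 1 - ‖star (A *ᵥ s) ⬝ᵥ t‖ ^ 2 with hqdef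
      have hq0 : 0 ≤ q := by
        have := norm_star_dotProduct_le_one hs' ht
        have := norm_nonneg (star (A *ᵥ s) ⬝ᵥ t)
        nlinarith
      have e : ‖star (A *ᵥ s) ⬝ᵥ t‖ ^ 2 = 1 - q := by rw [hqdef]; ring
      rw [e]
      exact hγ q hq0 hq

/-- Fixed-point amplification with `O(log (1/δ) / √p)` phases. -/
theorem exists_isFixedPoint {p δ : ℝ} (hp : 0 < p) (hδ : 0 < δ) (hδ1 : δ ≤ 1) :
    ∃ L : List (ℝ × ℝ), IsFixedPoint.{u} p δ L ∧
      (L.length : ℝ) ≤ 3 * (Real.log (2 / δ) / √p) := by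
  obtain ⟨n, hn, hn'⟩ := exists_three_pow (r := Real.log (2 / δ) / √p)
    (div_nonneg (Real.log_nonneg (by rw [le_div_iff₀ hδ]; linarith)) (Real.sqrt_nonneg p))
  -- With `a = √p` the initial invariant only needs `p ≤ |⟨s|t⟩|²`.
  obtain ⟨L, hlen, -, h⟩ := exists_amplification_phases.{u} (√p) n
  refine ⟨L, fun ι _ _ s t hs ht hst => ?_, ?_⟩
  · have h1 := h ι s t hs ht (cosh_sq_mul_le_one (by rw [Real.sq_sqrt hp.le]; linarith))
    have h2 := le_sq_of_cosh_sq_mul_le hδ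
      ((div_le_iff₀ (Real.sqrt_pos.2 hp)).1 hn) h1
    exact Real.sqrt_le_iff.2 ⟨hδ.le, h2⟩
  · have : (L.length : ℝ) + 1 = 3 ^ n := by exact_mod_cast hlen
    linarith

/-! ### Composing GQSP circuits -/

/-- The matrix of a GQSP circuit for the scalar signal `z`. -/
def GQSP.eval (G : GQSP) (z : ℂ) : Matrix (Fin 2) (Fin 2) ℂ := G.polyMatrix.map (Polynomial.eval z)

/-- The scalar signal `z`, controlled on the qubit being `|0⟩`. -/
def ctrlSignal (z : ℂ) : Matrix (Fin 2) (Fin 2) ℂ := Matrix.diagonal ![z, 1]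

lemma GQSP.eval_zero_zero (G : GQSP) (z : ℂ) : G.eval z 0 0 = G.polynomial.eval z := rfl

lemma GQSP.eval_nil (R : QubitGate) (z : ℂ) :
    GQSP.eval ⟨R, []⟩ z = (R : Matrix (Fin 2) (Fin 2) ℂ) := by
  ext i j
  simp [GQSP.eval, GQSP.polyMatrix]

lemma GQSP.polyMatrix_append (R R' : QubitGate) (l : List QubitGate) :
    GQSP.polyMatrix ⟨R, l ++ [R']⟩ = (R' : Matrix (Fin 2) (Fin 2) ℂ).map Polynomial.C *
      Matrix.diagonal ![Polynomial.X, 1] * GQSP.polyMatrix ⟨R, l⟩ := by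
  simp [GQSP.polyMatrix]

lemma GQSP.eval_append (R R' : QubitGate) (l : List QubitGate) (z : ℂ) :
    GQSP.eval ⟨R, l ++ [R']⟩ z =
      (R' : Matrix (Fin 2) (Fin 2) ℂ) * (ctrlSignal z * GQSP.eval ⟨R, l⟩ z) := by
  have h : ∀ M N : Matrix (Fin 2) (Fin 2) (Polynomial ℂ),
      (M * N).map (Polynomial.eval z) = M.map (Polynomial.eval z) * N.map (Polynomial.eval z) :=
    fun M N => Matrix.map_mul (f := Polynomial.evalRingHom z)
  have h1 : (Matrix.diagonal ![Polynomial.X, (1 : Polynomial ℂ)]).map (Polynomial.eval z) =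
      ctrlSignal z := by
    ext i j
    fin_cases i <;> fin_cases j <;> simp [ctrlSignal]
  have h2 : ((R' : Matrix (Fin 2) (Fin 2) ℂ).map Polynomial.C).map (Polynomial.eval z) =
      (R' : Matrix (Fin 2) (Fin 2) ℂ) := by
    ext i j
    simp
  rw [GQSP.eval, GQSP.polyMatrix_append, h, h, h1, h2, mul_assoc, GQSP.eval]

/-- A GQSP circuit with `d` signals realizes the matrix `M z` for all signals `z` in the circle. -/
def IsRealizable (d : ℕ) (M : ℂ → Matrix (Fin 2) (Fin 2) ℂ) : Prop :=
  ∃ G : GQSP, G.rest.length = d ∧ ∀ z : ℂ, ‖z‖ = 1 → G.eval z = M z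

namespace IsRealizable

variable {d e : ℕ} {M N : ℂ → Matrix (Fin 2) (Fin 2) ℂ}

lemma congr (h : IsRealizable d M) (hMN : ∀ z, ‖z‖ = 1 → M z = N z) : IsRealizable d N := by
  obtain ⟨G, hd, hG⟩ := h
  exact ⟨G, hd, fun z hz => (hG z hz).trans (hMN z hz)⟩

lemma const (R : QubitGate) : IsRealizable 0 fun _ => (R : Matrix (Fin 2) (Fin 2) ℂ) :=
  ⟨⟨R, []⟩, rfl, fun z _ => GQSP.eval_nil R z⟩

/-- The gate is absorbed into the last gate of the circuit, so no signal is added. -/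
lemma const_mul (R : QubitGate) (h : IsRealizable d M) :
    IsRealizable d fun z => (R : Matrix (Fin 2) (Fin 2) ℂ) * M z := by
  obtain ⟨⟨R₀, l⟩, hd, hG⟩ := h
  rcases List.eq_nil_or_concat l with rfl | ⟨l, R', rfl⟩
  · refine ⟨⟨R * R₀, []⟩, hd, fun z hz => ?_⟩
    beta_reduce
    rw [← hG z hz, GQSP.eval_nil, GQSP.eval_nil]
    rfl
  · rw [List.concat_eq_append] at hd hG
    refine ⟨⟨R₀, l ++ [R * R']⟩, by simpa using hd, fun z hz => ?_⟩
    beta_reduce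
    rw [← hG z hz, GQSP.eval_append, GQSP.eval_append]
    exact mul_assoc _ _ _

lemma ctrlSignal_mul (h : IsRealizable d M) :
    IsRealizable (d + 1) fun z => ctrlSignal z * M z := by
  obtain ⟨⟨R₀, l⟩, hd, hG⟩ := h
  refine ⟨⟨R₀, l ++ [1]⟩, by simpa using hd, fun z hz => ?_⟩
  rw [GQSP.eval_append, hG z hz]
  exact one_mul _

lemma ctrlSignal : IsRealizable 1 QSamplePrep.ctrlSignal :=
  (const 1).ctrlSignal_mul.congr fun _ _ => mul_one _

lemma mul (hM : IsRealizable d M) (hN : IsRealizable e N) :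
    IsRealizable (d + e) fun z => M z * N z := by
  obtain ⟨⟨R₀, l⟩, rfl, hG⟩ := hM
  refine IsRealizable.congr (M := fun z => GQSP.eval ⟨R₀, l⟩ z * N z) ?_
    fun z hz => by rw [hG z hz]
  clear hG
  induction l using List.reverseRecOn with
  | nil =>
    refine (by simpa using hN.const_mul R₀ : IsRealizable _ _).congr fun z _ => ?_
    rw [GQSP.eval_nil]
  | append_singleton l R ih =>
    have := (ih.ctrlSignal_mul).const_mul R
    rw [List.length_append, List.length_singleton, add_right_comm]
    exact this.congr fun z _ => by simp only [GQSP.eval_append, mul_assoc]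

/-- The Pauli gate `X`. -/
def pauliX : QubitGate :=
  ⟨!![0, 1; 1, 0], by
    rw [Matrix.mem_unitaryGroup_iff]
    ext i j
    fin_cases i <;> fin_cases j <;>
      simp [Matrix.mul_apply, Fin.sum_univ_two, Matrix.star_eq_conjTranspose]⟩

/-- A circuit contains no inverse signals. Conjugating the controlled signal by `X` gives `diag(1,
z) = z · diag(z, 1)†` on the circle, so each signal is inverted at the price of a factor `z`; these
multiply to `z ^ d`, a harmless phase. -/
lemma conjTranspose (h : IsRealizable d M) : IsRealizable d fun z => z ^ d • (M z)ᴴ := by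
  obtain ⟨⟨R₀, l⟩, rfl, hG⟩ := h
  refine IsRealizable.congr (M := fun z => z ^ l.length • (GQSP.eval ⟨R₀, l⟩ z)ᴴ) ?_
    fun z hz => by rw [hG z hz]
  clear hG
  induction l using List.reverseRecOn with
  | nil => exact (const R₀⁻¹).congr fun z _ => by simp [GQSP.eval_nil, Matrix.star_eq_conjTranspose]
  | append_singleton l R ih =>
    rw [List.length_append, List.length_singleton]
    refine (ih.mul ((const pauliX).mul (ctrlSignal.mul ((const pauliX).mul (const R⁻¹))))).congr
      fun z hz => ?_
    have hD : (pauliX : Matrix (Fin 2) (Fin 2) ℂ) * (QSamplePrep.ctrlSignal z * pauliX) =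
        z • (QSamplePrep.ctrlSignal z)ᴴ := by
      have hz' : z * (starRingEnd ℂ) z = 1 := by
        rw [Complex.mul_conj, Complex.normSq_eq_norm_sq, hz]; simp
      ext i j
      fin_cases i <;> fin_cases j <;>
        simp [pauliX, QSamplePrep.ctrlSignal, Matrix.mul_apply, Fin.sum_univ_two, hz']
    have hD' : (pauliX : Matrix (Fin 2) (Fin 2) ℂ) *
        (QSamplePrep.ctrlSignal z * (pauliX * (R⁻¹ : QubitGate))) =
        z • ((QSamplePrep.ctrlSignal z)ᴴ * (R : Matrix (Fin 2) (Fin 2) ℂ)ᴴ) := by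
      rw [← smul_mul_assoc, ← hD]
      simp [mul_assoc, Matrix.star_eq_conjTranspose]
    rw [hD', GQSP.eval_append, Matrix.conjTranspose_mul, Matrix.conjTranspose_mul, mul_assoc,
      smul_mul_smul_comm, ← pow_succ]

end IsRealizable

/-! ### Filters by nesting -/

lemma GQSP.eval_mem_unitary (G : GQSP) {z : ℂ} (hz : ‖z‖ = 1) :
    G.eval z ∈ Matrix.unitaryGroup (Fin 2) ℂ := by
  obtain ⟨R, l⟩ := G
  induction l using List.reverseRecOn with
  | nil => rw [GQSP.eval_nil]; exact R.2
  | append_singleton l R' ih =>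
    rw [GQSP.eval_append]
    refine mul_mem R'.2 (mul_mem ?_ ih)
    have hz' : z * (starRingEnd ℂ) z = 1 := by
      rw [Complex.mul_conj, Complex.normSq_eq_norm_sq, hz]; simp
    rw [Matrix.mem_unitaryGroup_iff]
    ext i j
    fin_cases i <;> fin_cases j <;>
      simp [ctrlSignal, Matrix.mul_apply, Fin.sum_univ_two, Matrix.star_eq_conjTranspose, hz']

/-- The Hadamard gate. -/
def hadamard : QubitGate :=
  ⟨((√2 : ℝ) : ℂ)⁻¹ • !![1, 1; 1, -1], by
    have h : (((√2 : ℝ) : ℂ))⁻¹ * (((√2 : ℝ) : ℂ))⁻¹ = 1 / 2 := by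
      rw [← mul_inv, ← Complex.ofReal_mul, Real.mul_self_sqrt (by norm_num)]; simp
    rw [Matrix.mem_unitaryGroup_iff]
    ext i j
    fin_cases i <;> fin_cases j <;>
      simp [Matrix.mul_apply, Fin.sum_univ_two, Matrix.star_eq_conjTranspose, h] <;> norm_num⟩

/-- Hadamard, controlled signal, Hadamard. At `z = e^{iθ}` the modulus is `|cos(θ/2)|`. -/
lemma exists_gqsp_linear :
    ∃ G : GQSP, G.rest.length = 1 ∧ ∀ z : ℂ, ‖z‖ = 1 → G.polynomial.eval z = (1 + z) / 2 := by
  obtain ⟨G, hd, hG⟩ :=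
    (IsRealizable.const hadamard).mul (IsRealizable.ctrlSignal.mul (IsRealizable.const hadamard))
  refine ⟨G, hd, fun z hz => ?_⟩
  have h : (((√2 : ℝ) : ℂ))⁻¹ * (((√2 : ℝ) : ℂ))⁻¹ = 1 / 2 := by
    rw [← mul_inv, ← Complex.ofReal_mul, Real.mul_self_sqrt (by norm_num)]; simp
  rw [← G.eval_zero_zero, hG z hz]
  simp [hadamard, ctrlSignal, Matrix.mul_apply, Fin.sum_univ_two]
  linear_combination (1 + z) * h

/-- One amplification step for the first column of a unitary. -/
lemma amplify_zero_zero {M : Matrix (Fin 2) (Fin 2) ℂ} (hM : M ∈ Matrix.unitaryGroup (Fin 2) ℂ)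
    (γ : ℝ) :
    (M * (Matrix.diagonal ![1, Complex.exp ((-γ : ℝ) * Complex.I)] * (Mᴴ *
      (Matrix.diagonal ![1, Complex.exp (γ * Complex.I)] * M)))) 0 0 =
      M 0 0 * ((1 - (2 - 2 * Real.cos γ) * (1 - ‖M 0 0‖ ^ 2) : ℝ) : ℂ) := by
  have h1 := congrFun (congrFun (Matrix.mem_unitaryGroup_iff'.1 hM) 0) 0
  have h2 := congrFun (congrFun (Matrix.mem_unitaryGroup_iff.1 hM) 0) 0
  have h3 := congrFun (congrFun (Matrix.mem_unitaryGroup_iff.1 hM) 0) 1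
  have hu : (starRingEnd ℂ) (M 0 0) * M 0 0 = ((‖M 0 0‖ ^ 2 : ℝ) : ℂ) := by
    rw [← Complex.normSq_eq_conj_mul_self, Complex.normSq_eq_norm_sq]
  have hexp : Complex.exp ((-γ : ℝ) * Complex.I) * Complex.exp (γ * Complex.I) = 1 := by
    rw [← Complex.exp_add]; simp
  have hcos : Complex.exp ((-γ : ℝ) * Complex.I) + Complex.exp (γ * Complex.I) =
      2 * ((Real.cos γ : ℝ) : ℂ) := by
    rw [Complex.ofReal_cos, Complex.cos]; push_cast; ring
  simp [Matrix.mul_apply, Fin.sum_univ_two, Matrix.star_eq_conjTranspose] at h1 h2 h3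
  simp [Matrix.mul_apply, Fin.sum_univ_two] at hexp hcos hu ⊢
  set f := Complex.exp (-(γ * Complex.I))
  set e := Complex.exp (γ * Complex.I)
  -- `h1` and `h2` normalize the first column and the first row of `M`, and `h3` is the
  -- orthogonality of its rows.
  linear_combination M 0 0 * (e - 1) * h1 + f * M 0 0 * h2 + f * e * M 1 0 * h3 -
    M 0 0 * M 1 0 * (starRingEnd ℂ) (M 1 0) * hexp + M 0 0 * (1 - (‖M 0 0‖ : ℂ) ^ 2) * hcos +
    M 0 0 * (2 - f - e) * hu

lemma diagonal_one_exp_mem_unitary (φ : ℝ) :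
    Matrix.diagonal ![1, Complex.exp (φ * Complex.I)] ∈ Matrix.unitaryGroup (Fin 2) ℂ := by
  have h : Complex.exp (φ * Complex.I) * Complex.exp (-(φ * Complex.I)) = 1 := by
    rw [← Complex.exp_add]; simp
  rw [Matrix.mem_unitaryGroup_iff]
  ext i j
  fin_cases i <;> fin_cases j <;>
    simp [Matrix.mul_apply, Matrix.star_eq_conjTranspose, ← Complex.exp_conj, h]

/-- Nesting `M ↦ M D(-γ) M† D(γ) M` runs the cubic recursion on `|Υ(z)|²`, up to the unimodular
factor from realizing `M†`. At `z = 1` the correction term vanishes because `|Υ(1)| = 1`, so the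
normalization survives for any `γ`. -/
lemma exists_gqsp_chebyshev (a : ℝ) (n : ℕ) :
    ∃ G : GQSP, G.rest.length = 3 ^ n ∧ G.polynomial.eval 1 = 1 ∧
      ∀ z : ℂ, ‖z‖ = 1 → Real.cosh a ^ 2 * ‖(1 + z) / 2‖ ^ 2 ≤ 1 →
        Real.cosh (3 ^ n * a) ^ 2 * ‖G.polynomial.eval z‖ ^ 2 ≤ 1 := by
  induction n with
  | zero =>
    obtain ⟨G, hd, hG⟩ := exists_gqsp_linear
    refine ⟨G, hd, ?_, fun z hz h => ?_⟩
    · rw [hG 1 (by simp)]; norm_num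
    · rw [hG z hz]; simpa using h
  | succ n ih =>
    obtain ⟨G, hd, h1, h⟩ := ih
    obtain ⟨γ, hγ⟩ := exists_angle (3 ^ n * a)
    have hG : IsRealizable (3 ^ n) G.eval := ⟨G, hd, fun _ _ => rfl⟩
    obtain ⟨G', hd', hG'⟩ := hG.mul ((IsRealizable.const
      ⟨_, diagonal_one_exp_mem_unitary (-γ)⟩).mul (hG.conjTranspose.mul ((IsRealizable.const
      ⟨_, diagonal_one_exp_mem_unitary γ⟩).mul hG)))
    have key : ∀ z : ℂ, ‖z‖ = 1 → G'.polynomial.eval z = z ^ 3 ^ n * (G.polynomial.eval z *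
        ((1 - (2 - 2 * Real.cos γ) * (1 - ‖G.polynomial.eval z‖ ^ 2) : ℝ) : ℂ)) := fun z hz => by
      rw [← G'.eval_zero_zero, hG' z hz, ← G.eval_zero_zero,
        ← amplify_zero_zero (G.eval_mem_unitary hz) γ]
      simp only [Matrix.smul_mul, Matrix.mul_smul, Matrix.smul_apply, smul_eq_mul]
    refine ⟨G', by rw [hd']; ring, ?_, fun z hz h0 => ?_⟩
    · rw [key 1 (by simp), h1]; simp
    · rw [key z hz, norm_mul, norm_pow, hz, one_pow, one_mul, norm_mul, mul_pow,
        Complex.norm_real, Real.norm_eq_abs, sq_abs, pow_succ (3 : ℝ) n, mul_comm (3 ^ n : ℝ) 3,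
        mul_assoc (3 : ℝ)]
      exact hγ _ (sq_nonneg _) (h z hz h0)

/-- A projector of error `ε` with `O(log (1/ε) / Δ)` signals. -/
theorem exists_isProjector {Δ ε : ℝ} (hΔ : 0 < Δ) (hε : 0 < ε) (hε1 : ε ≤ 1) :
    ∃ G : GQSP, G.IsProjector Δ ε ∧
      (G.rest.length : ℝ) ≤ 3 * (Real.pi * Real.log (2 / ε) / Δ) + 1 := by
  have hpi := Real.pi_pos
  have hlog : 0 ≤ Real.log (2 / ε) := Real.log_nonneg (by rw [le_div_iff₀ hε]; linarith)
  obtain ⟨n, hn, hn'⟩ := exists_three_pow (r := Real.pi * Real.log (2 / ε) / Δ) (by positivity)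
  obtain ⟨G, hd, h1, h⟩ := exists_gqsp_chebyshev (Δ / Real.pi) n
  refine ⟨G, ⟨h1, fun θ hθ hθ' => ?_⟩, by rw [hd]; exact_mod_cast hn'⟩
  have hz : ‖Complex.exp (θ * Complex.I)‖ = 1 := Complex.norm_exp_ofReal_mul_I θ
  have hq : ‖(1 + Complex.exp (θ * Complex.I)) / 2‖ ^ 2 = 1 - Real.sin (|θ| / 2) ^ 2 := by
    rw [← Complex.normSq_eq_norm_sq, Complex.normSq_div, Complex.exp_mul_I, ← Complex.ofReal_cos,
      ← Complex.ofReal_sin, Complex.normSq_apply, Real.sin_sq_eq_half_sub,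
      mul_div_cancel₀ _ two_ne_zero, Real.cos_abs]
    simp [-Complex.ofReal_cos, -Complex.ofReal_sin]
    have := Real.sin_sq_add_cos_sq θ
    linear_combination this / 4
  have h2 := h _ hz (by
    rw [hq]
    refine cosh_sq_mul_le_one ?_
    rw [sub_sub_cancel]
    refine pow_le_pow_left₀ (by positivity) ?_ 2
    -- Jordan's inequality `sin x ≥ 2x/π` on `[0, π/2]`, at `x = |θ|/2`, explains the choice `a =
    -- Δ/π`.
    calc Δ / Real.pi ≤ 2 / Real.pi * (|θ| / 2) := by
          rw [div_mul_div_comm, mul_comm Real.pi, mul_div_mul_left _ _ two_ne_zero]; gcongr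
      _ ≤ _ := Real.mul_le_sin (by positivity) (by linarith))
  refine (sq_le_sq₀ (norm_nonneg _) hε.le).1 (le_sq_of_cosh_sq_mul_le hε ?_ h2)
  rw [div_le_iff₀ hΔ] at hn
  rw [← mul_div_assoc, le_div_iff₀ hpi]
  linarith

/-! ### Counting queries -/

lemma Circuit.queries_append {ℓ : ℕ} (c c' : Circuit ℓ) :
    Circuit.queries (c ++ c') = Circuit.queries c + Circuit.queries c' := by
  simp [Circuit.queries]

lemma Circuit.queries_adjoint {ℓ : ℕ} (c : Circuit ℓ) :
    Circuit.queries (Circuit.adjoint c) = Circuit.queries c := by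
  have h : Gate.queries ∘ Gate.inv = (Gate.queries : Gate ℓ → ℕ) := by
    funext g
    cases g <;> rfl
  simp [Circuit.queries, Circuit.adjoint, List.sum_reverse, h]

lemma Circuit.queries_flatMap {ℓ : ℕ} {α : Type*} (l : List α) (f : α → Circuit ℓ) {q : ℕ}
    (hf : ∀ a ∈ l, Circuit.queries (f a) = q) : Circuit.queries (l.flatMap f) = l.length * q := by
  induction l with
  | nil => simp [Circuit.queries]
  | cons a l ih =>
    rw [List.flatMap_cons, Circuit.queries_append, hf a List.mem_cons_self,
      ih fun b hb => hf b (List.mem_cons_of_mem _ hb), List.length_cons]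
    ring

lemma GQSP.queries_circuit {ℓ : ℕ} (G : GQSP) (j : Fin (ℓ + 1)) :
    Circuit.queries (G.circuit j) = 2 * G.rest.length := by
  have h := Circuit.queries_flatMap G.rest (fun R => ctrlWalk j ++ [Gate.qubit R]) (q := 2)
    fun R _ => by simp [Circuit.queries, ctrlWalk, Gate.queries]
  have h' : Circuit.queries (G.circuit j) =
      Circuit.queries [(Gate.qubit G.first : Gate ℓ)] + Circuit.queries
        (G.rest.flatMap fun R => ctrlWalk j ++ [Gate.qubit R]) :=
    Circuit.queries_append [_] _
  rw [h', h]
  simp [Circuit.queries, Gate.queries, mul_comm]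

lemma queries_selectivePhaseCircuit {ℓ : ℕ} (G : GQSP) (j : Fin (ℓ + 1)) (φ : ℝ) :
    Circuit.queries (selectivePhaseCircuit G j φ) = 2 + 4 * G.rest.length := by
  simp only [selectivePhaseCircuit, Circuit.queries_append, Circuit.queries_adjoint,
    GQSP.queries_circuit]
  simp [Circuit.queries, Gate.queries]
  ring

lemma queries_algorithm {ℓ : ℕ} (L : List (ℝ × ℝ)) (G : GQSP) (a b : ℝ) :
    Circuit.queries (algorithm (ℓ := ℓ) fun _ => ⟨L, G, G, a, b⟩) =
      ℓ * (L.length * (4 + 8 * G.rest.length)) := by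
  rw [algorithm, Circuit.queries_flatMap (q := L.length * (4 + 8 * G.rest.length)),
    List.length_finRange]
  intro i _
  refine Circuit.queries_flatMap _ _ fun a _ => ?_
  rw [Circuit.queries_append, queries_selectivePhaseCircuit, queries_selectivePhaseCircuit]
  ring

/-! ### The query bound -/

lemma IsFixedPoint.mono {p p' δ : ℝ} {L : List (ℝ × ℝ)} (h : IsFixedPoint.{u} p δ L)
    (hp : p ≤ p') : IsFixedPoint.{u} p' δ L :=
  fun ι _ _ s t hs ht hst => h ι s t hs ht (hp.trans hst)

lemma GQSP.IsProjector.mono {Δ Δ' ε : ℝ} {G : GQSP} (h : G.IsProjector Δ ε) (hΔ : Δ ≤ Δ') :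
    G.IsProjector Δ' ε :=
  ⟨h.1, fun θ hθ hθ' => h.2 θ (hΔ.trans hθ) hθ'⟩

/-- The stage budget `η` is split evenly between the ideal amplification and the `2m` compiled
phases, where `m` is the number of phase pairs; the filter is chosen after the phases because its
error depends on `m`. -/
lemma exists_stage_parameters {p Δ η : ℝ} (hp : 0 < p) (hΔ : 0 < Δ) (hη : 0 < η) (hη1 : η ≤ 1) :
    ∃ (L : List (ℝ × ℝ)) (G : GQSP) (δ : ℝ), 0 < δ ∧ δ < 1 ∧
      η / 2 + 2 * ((2 * L.length + 1 : ℝ) - 1) * δ ≤ η ∧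
      IsFixedPoint.{u} p (η / 2) L ∧ G.IsProjector Δ δ ∧
      (L.length : ℝ) ≤ 3 * (Real.log (4 / η) / √p) ∧
      (G.rest.length : ℝ) ≤
        3 * (Real.pi * Real.log (16 * (L.length + 1) / η) / Δ) + 1 := by
  obtain ⟨L, hL, hlen⟩ := exists_isFixedPoint.{u} hp (half_pos hη) (by linarith)
  have hm : (0 : ℝ) ≤ L.length := by positivity
  -- The accumulated filter error is `4mδ ≤ η/2`; the `+ 1` keeps the denominator positive when `m =
  -- 0`.
  set δ := η / (8 * (L.length + 1)) with hδ
  have hδ0 : 0 < δ := by positivity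
  have hδ1 : δ < 1 := by rw [hδ, div_lt_one (by positivity)]; linarith
  obtain ⟨G, hG, hGlen⟩ := exists_isProjector hΔ hδ0 hδ1.le
  refine ⟨L, G, δ, hδ0, hδ1, ?_, hL, hG, ?_, ?_⟩
  · have : δ * (8 * (L.length + 1)) = η := div_mul_cancel₀ _ (by positivity)
    nlinarith
  · rwa [show 4 / η = 2 / (η / 2) by field_simp; norm_num]
  · rwa [show 16 * ((L.length : ℝ) + 1) / η = 2 / δ by rw [hδ]; field_simp; norm_num]

/-- Since `e ≤ 1/2` and `l ≥ 1`, both logarithms of the bound stay above positive constants, so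
additive constants can be absorbed into them. The bounds `9 g/√p` for `m` and `2880 h/Δ` for `4 +
8d` multiply to the constant `25920`. -/
lemma query_bound_arithmetic {l p Δ e m d : ℝ} (hl : 1 ≤ l) (hp : 0 < p) (hp1 : p ≤ 1)
    (hΔ : 0 < Δ) (hΔ1 : Δ ≤ 2 * Real.pi) (he : 0 < e) (he1 : e ≤ 1 / 2) (hm0 : 0 ≤ m)
    (hm : m ≤ 3 * (Real.log (4 / (e / l)) / √p))
    (hd : d ≤ 3 * (Real.pi * Real.log (16 * (m + 1) / (e / l)) / Δ) + 1) :
    l * (m * (4 + 8 * d)) ≤ 30000 * (l / (√p * Δ) * Real.log (l / e) *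
      Real.log (l / (e * √p) * Real.log (l / e))) := by
  have hs : 0 < √p := Real.sqrt_pos.2 hp
  have hs1 : √p ≤ 1 := Real.sqrt_le_one.2 hp1
  have hpi := Real.pi_pos
  have hpi4 := Real.pi_le_four
  set X := l / e with hX
  have hX2 : 2 ≤ X := by rw [hX, le_div_iff₀ he]; linarith
  set g := Real.log X with hg
  have hg0 : (0.69 : ℝ) ≤ g := by
    have h1 := Real.log_two_gt_d9
    have h2 := Real.log_le_log (by norm_num) hX2
    linarith
  set Y := l / (e * √p) * g with hY
  have hXY : Y = X * (g / √p) := by rw [hY, hX]; field_simp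
  have hgs : g ≤ g / √p := by rw [le_div_iff₀ hs]; nlinarith
  have hY1 : (1.38 : ℝ) ≤ Y := by rw [hXY]; nlinarith
  have hYpos : 0 < Y := by linarith
  set h := Real.log Y with hh
  have hh0 : (0.27 : ℝ) ≤ h := by
    have h1 := Real.one_sub_inv_le_log_of_pos hYpos
    have h2 : Y⁻¹ ≤ 0.73 := by
      rw [inv_le_comm₀ hYpos (by norm_num)]
      exact le_trans (by norm_num) hY1
    linarith
  have hlog4 : Real.log (4 / (e / l)) ≤ 3 * g := by
    have : 4 / (e / l) = 4 * X := by rw [hX]; field_simp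
    -- Since `X ≥ 2`, `4X ≤ X³`.
    rw [this, hg, ← Real.log_rpow (by linarith)]
    refine Real.log_le_log (by linarith) ?_
    norm_cast
    nlinarith [mul_nonneg (mul_nonneg (by linarith : 0 ≤ X) (sub_nonneg.2 hX2))
      (by linarith : 0 ≤ X + 2)]
  have hm' : m ≤ 9 * (g / √p) := by
    calc m ≤ 3 * (Real.log (4 / (e / l)) / √p) := hm
      _ ≤ 3 * (3 * g / √p) := by gcongr
      _ = _ := by ring
  have hlog16 : Real.log (16 * (m + 1) / (e / l)) ≤ 26 * h := by
    have e1 : 16 * (m + 1) / (e / l) = 16 * (m + 1) * X := by rw [hX]; field_simp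
    have e2 : 16 * (m + 1) * X ≤ 200 * Y := by
      rw [hXY]
      have : 16 * (m + 1) ≤ 200 * (g / √p) := by linarith
      nlinarith
    rw [e1]
    calc Real.log (16 * (m + 1) * X) ≤ Real.log (200 * Y) :=
          Real.log_le_log (by positivity) e2
      _ = Real.log 200 + h := Real.log_mul (by norm_num) hYpos.ne'
      _ ≤ 26 * h := by
        have : Real.log 200 ≤ 8 * Real.log 2 := by
          rw [← Real.log_rpow (by norm_num)]
          exact Real.log_le_log (by norm_num) (by norm_num)
        have := Real.log_two_lt_d9
        linarith
  have hd' : 4 + 8 * d ≤ 2880 * (h / Δ) := by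
    have h1 : Real.pi * Real.log (16 * (m + 1) / (e / l)) / Δ ≤ 4 * (26 * h) / Δ :=
      calc _ ≤ Real.pi * (26 * h) / Δ := by gcongr
        _ ≤ _ := by gcongr
    -- The additive constants become multiples of `h/Δ` because `Δ ≤ 2π ≤ 8`; this is where the
    -- upper bound on the gap parameters enters.
    have h2 : 1 ≤ 8 * (h / 0.27) / Δ := by
      rw [le_div_iff₀ hΔ, one_mul]
      have : (0.27 : ℝ) ≤ h := hh0
      have : 1 ≤ h / 0.27 := by rw [le_div_iff₀ (by norm_num)]; linarith
      linarith
    have h3 : 4 * (26 * h) / Δ = 104 * (h / Δ) := by ring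
    have h4 : 8 * (h / 0.27) / Δ = 800 / 27 * (h / Δ) := by ring
    linarith
  calc l * (m * (4 + 8 * d)) ≤ l * (9 * (g / √p) * (2880 * (h / Δ))) := by
        have : 0 ≤ g / √p := by linarith
        have : 0 ≤ 2880 * (h / Δ) := by positivity
        exact mul_le_mul_of_nonneg_left ((mul_le_mul_of_nonneg_left hd' hm0).trans
          (mul_le_mul_of_nonneg_right hm' this)) (by linarith)
    _ = 25920 * (l / (√p * Δ) * g * h) := by field_simp; norm_num
    _ ≤ 30000 * (l / (√p * Δ) * g * h) := by
        have : 0 ≤ l / (√p * Δ) * g * h := by positivity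
        linarith

theorem exists_admissible_data :
    ∃ C : ℝ, 0 < C ∧
      ∀ (ℓ : ℕ) (p : Fin ℓ → ℝ) (Δ : Fin (ℓ + 1) → ℝ) (pmin Δmin ε : ℝ),
        (∀ i, 0 < p i ∧ p i ≤ 1) →
        (∀ j, 0 < Δ j ∧ Δ j ≤ 2 * Real.pi) →
        IsLeast (Set.range p) pmin →
        IsLeast (Set.range Δ) Δmin →
        0 < ε → ε < 1 →
        ∃ A : Fin ℓ → Stage, IsAdmissible.{u} A p Δ ε ∧
          (Circuit.queries (algorithm A) : ℝ) ≤ C * queryBound ℓ pmin Δmin (min ε (1 / 2)) := by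
  refine ⟨30000, by norm_num, fun ℓ p Δ pmin Δmin ε hp hΔ hpmin hΔmin hε hε1 => ?_⟩
  obtain ⟨⟨i₀, rfl⟩, hpmin⟩ := hpmin
  obtain ⟨⟨j₀, rfl⟩, hΔmin⟩ := hΔmin
  have hℓ : (1 : ℝ) ≤ ℓ := by exact_mod_cast i₀.pos
  set e := min ε (1 / 2) with he
  have he0 : 0 < e := lt_min hε (by norm_num)
  have he1 : e ≤ 1 / 2 := min_le_right _ _
  have hη : 0 < e / ℓ := by positivity
  have hη1 : e / ℓ ≤ 1 := by rw [div_le_one (by linarith)]; linarith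
  obtain ⟨L, G, δ, hδ, hδ1, herr, hL, hG, hlen, hd⟩ :=
    exists_stage_parameters.{u} (hp i₀).1 (hΔ j₀).1 hη hη1
  -- All stages share the data for the smallest overlap and gap; both requirements are monotone.
  refine ⟨fun _ => ⟨L, G, G, e / ℓ / 2, δ⟩, fun i => ⟨⟨by positivity, by linarith⟩, ⟨hδ, hδ1⟩, ?_,
    hL.mono (hpmin ⟨i, rfl⟩), hG.mono (hΔmin ⟨_, rfl⟩), hG.mono (hΔmin ⟨_, rfl⟩)⟩, ?_⟩
  · have : e / ℓ ≤ ε / ℓ := by gcongr; exact min_le_left _ _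
    refine le_trans (le_of_eq ?_) (herr.trans this)
    simp [Stage.L]
  · rw [queries_algorithm, queryBound]
    push_cast
    exact query_bound_arithmetic hℓ (hp i₀).1 (hp i₀).2 (hΔ j₀).1 (hΔ j₀).2 he0 he1
      (by positivity) hlen hd

/-! ### Trace distance -/

section TraceDist

variable {ι : Type u} [Fintype ι]

/-- Pythagoras for the line through `w`: the minimum over `c`, at the projection coefficient, is the
squared trace distance. Both the comparison with the norm and the triangle inequality come from
this. -/
lemma norm_sub_smul_sq {E : Type*} [NormedAddCommGroup E] [InnerProductSpace ℂ E] {u w : E}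
    (hu : ‖u‖ = 1) (hw : ‖w‖ = 1) (c : ℂ) :
    ‖u - c • w‖ ^ 2 = 1 - ‖inner ℂ u w‖ ^ 2 + ‖c - inner ℂ w u‖ ^ 2 := by
  have h := norm_sub_sq (𝕜 := ℂ) u (c • w)
  have h2 := norm_inner_symm (𝕜 := ℂ) u w
  have h3 : ‖c - inner ℂ w u‖ ^ 2 =
      ‖c‖ ^ 2 - 2 * RCLike.re (inner ℂ u (c • w)) + ‖inner ℂ w u‖ ^ 2 := by
    have h4 := norm_sub_sq (𝕜 := ℂ) c (inner ℂ w u)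
    rw [h4, inner_smul_right, RCLike.inner_apply, ← inner_conj_symm u w]
    generalize inner ℂ w u = X
    congr 3
    simp [mul_comm]
  rw [h, h3, norm_smul, hu, hw, h2]
  ring

lemma traceDist_le_norm_sub_smul {v w : ι → ℂ} (hv : star v ⬝ᵥ v = 1) (hw : star w ⬝ᵥ w = 1)
    (c : ℂ) : traceDist v w ≤ ‖WithLp.toLp 2 v - c • WithLp.toLp 2 w‖ := by
  rw [traceDist, star_dotProduct_eq_inner]
  refine Real.sqrt_le_iff.2 ⟨norm_nonneg _, ?_⟩
  rw [norm_sub_smul_sq ((norm_toLp_eq_one_iff v).2 hv) ((norm_toLp_eq_one_iff w).2 hw)]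
  exact le_add_of_nonneg_right (sq_nonneg _)

lemma traceDist_eq_norm_sub_smul {v w : ι → ℂ} (hv : star v ⬝ᵥ v = 1) (hw : star w ⬝ᵥ w = 1) :
    traceDist v w = ‖WithLp.toLp 2 v - (star w ⬝ᵥ v) • WithLp.toLp 2 w‖ := by
  rw [traceDist, star_dotProduct_eq_inner, star_dotProduct_eq_inner]
  have h := norm_sub_smul_sq ((norm_toLp_eq_one_iff v).2 hv) ((norm_toLp_eq_one_iff w).2 hw)
    (inner ℂ (WithLp.toLp 2 w) (WithLp.toLp 2 v))
  rw [← Real.sqrt_sq (norm_nonneg (_ - _)), h]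
  simp

/-- Project `u` to the line of `v` and then to that of `w`; the resulting multiple of `w` is a
competitor in the minimization, and the first projection coefficient has modulus at most one. -/
lemma traceDist_triangle {u v w : ι → ℂ} (hu : star u ⬝ᵥ u = 1) (hv : star v ⬝ᵥ v = 1)
    (hw : star w ⬝ᵥ w = 1) : traceDist u w ≤ traceDist u v + traceDist v w := by
  refine (traceDist_le_norm_sub_smul hu hw ((star v ⬝ᵥ u) * (star w ⬝ᵥ v))).trans ?_
  rw [traceDist_eq_norm_sub_smul hu hv, traceDist_eq_norm_sub_smul hv hw]
  have e : WithLp.toLp 2 u - ((star v ⬝ᵥ u) * (star w ⬝ᵥ v)) • WithLp.toLp 2 w =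
      (WithLp.toLp 2 u - (star v ⬝ᵥ u) • WithLp.toLp 2 v) +
        (star v ⬝ᵥ u) • (WithLp.toLp 2 v - (star w ⬝ᵥ v) • WithLp.toLp 2 w) := by
    module
  rw [e]
  refine (norm_add_le _ _).trans (add_le_add le_rfl ?_)
  rw [norm_smul]
  exact mul_le_of_le_one_left (norm_nonneg _) (norm_star_dotProduct_le_one hv hu)

lemma traceDist_le_norm_sub {v w : ι → ℂ} (hv : star v ⬝ᵥ v = 1) (hw : star w ⬝ᵥ w = 1) :
    traceDist v w ≤ ‖WithLp.toLp 2 (v - w)‖ := by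
  simpa using traceDist_le_norm_sub_smul hv hw 1

variable [DecidableEq ι]

lemma traceDist_mulVec {U : Matrix ι ι ℂ} (hU : U ∈ Matrix.unitaryGroup ι ℂ) (v w : ι → ℂ) :
    traceDist (U *ᵥ v) (U *ᵥ w) = traceDist v w := by
  rw [traceDist, traceDist, star_dotProduct_mulVec_self hU]

lemma norm_toLp_mulVec {U : Matrix ι ι ℂ} (hU : U ∈ Matrix.unitaryGroup ι ℂ) (v : ι → ℂ) :
    ‖WithLp.toLp 2 (U *ᵥ v)‖ = ‖WithLp.toLp 2 v‖ := by
  rw [norm_eq_sqrt_re_inner (𝕜 := ℂ), norm_eq_sqrt_re_inner (𝕜 := ℂ) (WithLp.toLp 2 v),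
    ← star_dotProduct_eq_inner, ← star_dotProduct_eq_inner, star_dotProduct_mulVec_self hU]

end TraceDist

/-! ### Polynomials of a unitary away from its fixed space -/

open scoped Matrix.Norms.L2Operator in
/-- A polynomial of a unitary `W` that is small on the eigenvalues other than `1` is small on the
orthogonal complement of the fixed space of `W`. -/
theorem norm_aeval_mulVec_le {κ : Type*} [Fintype κ] [DecidableEq κ] {W : Matrix κ κ ℂ}
    (hW : W ∈ Matrix.unitaryGroup κ ℂ) (Υ : Polynomial ℂ) {ε : ℝ} (hε : 0 ≤ ε)
    (hΥ : ∀ z ∈ spectrum ℂ W, z ≠ 1 → ‖Υ.eval z‖ ≤ ε) {v : κ → ℂ}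
    (hv : ∀ w, W *ᵥ w = w → star w ⬝ᵥ v = 0) :
    ‖WithLp.toLp 2 (Polynomial.aeval W Υ *ᵥ v)‖ ≤ ε * ‖WithLp.toLp 2 v‖ := by
  have hn : IsStarNormal W := ⟨by
    have h1 := Matrix.mem_unitaryGroup_iff.1 hW
    have h2 := Matrix.mem_unitaryGroup_iff'.1 hW
    rw [commute_iff_eq, h1, h2]⟩
  have hfin : (spectrum ℂ W).Finite := Matrix.finite_spectrum W
  have hcont : ∀ f : ℂ → ℂ, ContinuousOn f (spectrum ℂ W) := fun f => hfin.continuousOn f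
  -- The indicator of the eigenvalue `1` is continuous on the finite spectrum, so the functional
  -- calculus yields the spectral projection `P` onto the fixed space; the hypothesis on `v` says
  -- that `P` kills it.
  set g : ℂ → ℂ := fun z => if z = 1 then 1 else 0 with hg
  set P := cfc g W with hP
  have hWP : W * P = P := by
    conv_lhs => rw [← cfc_id ℂ W]
    rw [hP, ← cfc_mul id g W (hcont _) (hcont _)]
    congr 1
    funext z
    by_cases h : z = 1 <;> simp [hg, h]
  have hPs : Pᴴ = P := by
    rw [← Matrix.star_eq_conjTranspose, hP, ← cfc_star]
    congr 1
    funext z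
    by_cases h : z = 1 <;> simp [hg, h]
  have hPv : P *ᵥ v = 0 := by
    have h := hv (P *ᵥ (P *ᵥ v)) (by rw [Matrix.mulVec_mulVec, hWP])
    rw [Matrix.star_mulVec, hPs, ← Matrix.dotProduct_mulVec] at h
    rw [star_dotProduct_eq_inner, inner_self_eq_zero] at h
    exact (WithLp.toLp_eq_zero 2).1 h
  have key : Polynomial.aeval W Υ = cfc (fun z => Υ.eval z * (1 - g z)) W +
      Polynomial.aeval W Υ * P := by
    rw [← cfc_polynomial Υ W, hP, ← cfc_mul _ _ W (hcont _) (hcont _),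
      ← cfc_add W _ _ (hcont _) (hcont _)]
    congr 1
    funext z
    ring
  have h1 : Polynomial.aeval W Υ *ᵥ v = cfc (fun z => Υ.eval z * (1 - g z)) W *ᵥ v := by
    rw [key, Matrix.add_mulVec, ← Matrix.mulVec_mulVec, hPv, Matrix.mulVec_zero, add_zero]
  rw [h1]
  refine (Matrix.l2_opNorm_mulVec _ (WithLp.toLp 2 v)).trans ?_
  refine mul_le_mul_of_nonneg_right (norm_cfc_le hε fun z hz => ?_) (norm_nonneg _)
  by_cases h : z = 1
  · simpa [hg, h] using hε
  · simpa [hg, h] using hΥ z hz h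

/-! ### The walk of a reversible ergodic chain -/

lemma conjTranspose_swapMatrix (Ω : Type u) [DecidableEq Ω] : (swapMatrix Ω)ᴴ = swapMatrix Ω := by
  ext z w
  have : w = z.swap ↔ z = w.swap :=
    ⟨fun h => by rw [h, Prod.swap_swap], fun h => by rw [h, Prod.swap_swap]⟩
  simp [swapMatrix, this, apply_ite]

section Walk

variable {Ω : Type u} [Fintype Ω] [DecidableEq Ω] {P : Matrix Ω Ω ℝ} {π : Ω → ℝ}

lemma stepIsometry_mulVec (P : Matrix Ω Ω ℝ) (v : Ω → ℂ) (z : Ω × Ω) :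
    (stepIsometry P *ᵥ v) z = ((√(P z.1 z.2) : ℝ) : ℂ) * v z.1 := by
  simp [stepIsometry, Matrix.mulVec, dotProduct]

lemma swapMatrix_mulVec (v : Ω × Ω → ℂ) (z : Ω × Ω) : (swapMatrix Ω *ᵥ v) z = v z.swap := by
  have : ∀ w : Ω × Ω, z = w.swap ↔ w = z.swap := fun w =>
    ⟨fun h => by rw [h, Prod.swap_swap], fun h => by rw [h, Prod.swap_swap]⟩
  simp [swapMatrix, Matrix.mulVec, dotProduct, this]

lemma swapMatrix_mul_self : swapMatrix Ω * swapMatrix Ω = 1 := by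
  refine Matrix.ext_iff_mulVec.2 fun v => ?_
  ext z
  rw [← Matrix.mulVec_mulVec, swapMatrix_mulVec, swapMatrix_mulVec, Prod.swap_swap,
    Matrix.one_mulVec]

lemma IsReversibleErgodic.stepIsometry_isometry (h : IsReversibleErgodic P π) :
    (stepIsometry P)ᴴ * stepIsometry P = 1 := by
  ext x y
  have hrow : ∑ z, ((√(P y z) : ℝ) : ℂ) * ((√(P y z) : ℝ) : ℂ) = 1 := by
    simp_rw [← Complex.ofReal_mul, Real.mul_self_sqrt (h.ergodic.nonneg _ _)]
    exact_mod_cast Matrix.sum_row_of_mem_rowStochastic h.stochastic y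
  rw [Matrix.mul_apply, Fintype.sum_prod_type]
  simp [stepIsometry, apply_ite]
  by_cases hxy : x = y
  · subst hxy; simpa using hrow
  · simp [hxy, Ne.symm hxy]

lemma IsReversibleErgodic.walk_mem_unitary (h : IsReversibleErgodic P π) :
    walk P ∈ Matrix.unitaryGroup (Ω × Ω) ℂ := by
  have hS : swapMatrix Ω ∈ Matrix.unitaryGroup (Ω × Ω) ℂ := by
    rw [Matrix.mem_unitaryGroup_iff, Matrix.star_eq_conjTranspose, conjTranspose_swapMatrix,
      swapMatrix_mul_self]
  refine mul_mem ?_ hS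
  rw [Matrix.mem_unitaryGroup_iff, Matrix.star_eq_conjTranspose]
  have e : stepIsometry P * (stepIsometry P)ᴴ * (stepIsometry P * (stepIsometry P)ᴴ) =
      stepIsometry P * (stepIsometry P)ᴴ := by
    rw [Matrix.mul_assoc (stepIsometry P), ← Matrix.mul_assoc (stepIsometry P)ᴴ,
      h.stepIsometry_isometry, Matrix.one_mul]
  simp only [Matrix.conjTranspose_sub, Matrix.conjTranspose_smul, Matrix.conjTranspose_mul,
    Matrix.conjTranspose_conjTranspose, Matrix.conjTranspose_one, sub_mul, mul_sub, smul_mul_assoc,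
    mul_smul_comm, e, one_mul, mul_one]
  simp
  module

end Walk

/-! ### The fixed space of the walk -/

section FixedSpace

variable {Ω : Type u} [Fintype Ω] [DecidableEq Ω] {P : Matrix Ω Ω ℝ} {π : Ω → ℝ}

/-- Stationarity passes to a power of `P` with all entries positive, and `π` has some nonzero entry.
-/
lemma IsReversibleErgodic.pos (h : IsReversibleErgodic P π) (y : Ω) : 0 < π y := by
  have hπ : π ᵥ* P = π := by
    ext y
    simp only [Matrix.vecMul, dotProduct, h.detailed_balance _ y]
    rw [← Finset.mul_sum, Matrix.sum_row_of_mem_rowStochastic h.stochastic, mul_one]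
  obtain ⟨k, -, hk⟩ := h.ergodic.exists_pos_pow
  have hπk : π ᵥ* P ^ k = π := by
    clear hk
    induction k with
    | zero => simp
    | succ k ih => rw [pow_succ, ← Matrix.vecMul_vecMul, ih, hπ]
  obtain ⟨x, -, hx⟩ : ∃ x ∈ Finset.univ, π x ≠ 0 :=
    Finset.exists_ne_zero_of_sum_ne_zero (by rw [h.sum_eq_one]; exact one_ne_zero)
  rw [← hπk]
  refine Finset.sum_pos' (fun z _ => mul_nonneg (h.nonneg z) (hk z y).le) ⟨x, Finset.mem_univ x, ?_⟩
  exact mul_pos ((h.nonneg x).lt_of_ne' hx) (hk x y)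

/-- Maximum principle for an entrywise positive power of `P`: at a maximum, a strictly positive
average equals the largest value. -/
lemma IsReversibleErgodic.harmonic_const (h : IsReversibleErgodic P π) {u : Ω → ℝ}
    (hu : P *ᵥ u = u) (x y : Ω) : u x = u y := by
  obtain ⟨k, -, hk⟩ := h.ergodic.exists_pos_pow
  have huk : P ^ k *ᵥ u = u := by
    clear hk
    induction k with
    | zero => simp
    | succ k ih => rw [pow_succ, ← Matrix.mulVec_mulVec, hu, ih]
  have : Nonempty Ω := ⟨x⟩
  obtain ⟨m, hm⟩ := Finite.exists_max u
  have hsum : ∑ z, (P ^ k) m z * (u m - u z) = 0 := by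
    simp only [mul_sub, Finset.sum_sub_distrib, ← Finset.sum_mul]
    rw [Matrix.sum_row_of_mem_rowStochastic (pow_mem h.stochastic k), one_mul, sub_eq_zero]
    exact (congrFun huk m).symm
  have hz : ∀ z, u m = u z := fun z => by
    have := (Finset.sum_eq_zero_iff_of_nonneg fun z _ =>
      mul_nonneg (hk m z).le (sub_nonneg.2 (hm z))).1 hsum z (Finset.mem_univ z)
    rcases mul_eq_zero.1 this with h' | h'
    · exact absurd h' (hk m z).ne'
    · exact sub_eq_zero.1 h'
  rw [← hz x, ← hz y]

lemma conjTranspose_stepIsometry_mulVec (P : Matrix Ω Ω ℝ) (v : Ω × Ω → ℂ) (x : Ω) :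
    ((stepIsometry P)ᴴ *ᵥ v) x = ∑ y, ((√(P x y) : ℝ) : ℂ) * v (x, y) := by
  simp [stepIsometry, Matrix.mulVec, dotProduct, Fintype.sum_prod_type, apply_ite, ite_mul,
    Finset.sum_ite_irrel]

lemma IsReversibleErgodic.qsample_unit (h : IsReversibleErgodic P π) :
    star (qsample π) ⬝ᵥ qsample π = 1 := by
  have : ∀ x, (starRingEnd ℂ) ((√(π x) : ℝ) : ℂ) * ((√(π x) : ℝ) : ℂ) = (π x : ℂ) := fun x => by
    rw [Complex.conj_ofReal, ← Complex.ofReal_mul, Real.mul_self_sqrt (h.nonneg x)]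
  simp only [dotProduct, Pi.star_apply, qsample, Complex.star_def, this]
  exact_mod_cast h.sum_eq_one

lemma IsReversibleErgodic.walk_mulVec_qsample (h : IsReversibleErgodic P π) :
    walk P *ᵥ (stepIsometry P *ᵥ qsample π) = stepIsometry P *ᵥ qsample π := by
  -- The amplitude at `(x, y)` is `√(π(x) P(x,y))`, which is symmetric by detailed balance.
  have hS : swapMatrix Ω *ᵥ (stepIsometry P *ᵥ qsample π) = stepIsometry P *ᵥ qsample π := by
    ext ⟨x, y⟩
    rw [swapMatrix_mulVec, stepIsometry_mulVec, stepIsometry_mulVec]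
    simp only [qsample, Prod.swap, ← Complex.ofReal_mul]
    rw [← Real.sqrt_mul (h.ergodic.nonneg _ _), ← Real.sqrt_mul (h.ergodic.nonneg _ _),
      mul_comm, h.detailed_balance, mul_comm]
  rw [walk, ← Matrix.mulVec_mulVec, hS, Matrix.mulVec_mulVec, Matrix.sub_mul, Matrix.smul_mul,
    Matrix.mul_assoc, h.stepIsometry_isometry, Matrix.mul_one, Matrix.one_mul, two_smul,
    add_sub_cancel_right]

/-- The step isometry pulls every fixed vector of the walk back to a multiple of the QSample. -/
lemma IsReversibleErgodic.exists_eq_smul_qsample (h : IsReversibleErgodic P π) {w : Ω × Ω → ℂ}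
    (hw : walk P *ᵥ w = w) : ∃ c : ℂ, (stepIsometry P)ᴴ *ᵥ w = c • qsample π := by
  set T := stepIsometry P with hT
  set a := Tᴴ *ᵥ w with ha
  have hTT := h.stepIsometry_isometry
  have hw' : (2 : ℂ) • (T *ᵥ (Tᴴ *ᵥ (swapMatrix Ω *ᵥ w))) - swapMatrix Ω *ᵥ w = w := by
    conv_rhs => rw [← hw]
    rw [walk, ← Matrix.mulVec_mulVec, Matrix.sub_mulVec, Matrix.smul_mulVec, Matrix.one_mulVec,
      ← Matrix.mulVec_mulVec]
  have h1 : Tᴴ *ᵥ (swapMatrix Ω *ᵥ w) = a := by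
    have := congrArg (Tᴴ *ᵥ ·) hw'
    simp only [Matrix.mulVec_sub, Matrix.mulVec_smul] at this
    rw [Matrix.mulVec_mulVec _ Tᴴ T, hTT, Matrix.one_mulVec, two_smul, add_sub_cancel_right] at this
    exact this
  -- So `a` is fixed by the discriminant `T† S T`. Nothing is claimed about the part of `w` outside
  -- the range of `T`.
  have h2 : Tᴴ *ᵥ (swapMatrix Ω *ᵥ (T *ᵥ a)) = a := by
    have := congrArg (fun v => Tᴴ *ᵥ (swapMatrix Ω *ᵥ v)) hw'
    simp only [Matrix.mulVec_sub, Matrix.mulVec_smul] at this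
    rw [h1, Matrix.mulVec_mulVec _ (swapMatrix Ω) (swapMatrix Ω), swapMatrix_mul_self,
      Matrix.one_mulVec, ← ha, two_smul, sub_eq_iff_eq_add, ← two_smul ℂ, ← two_smul ℂ] at this
    exact smul_right_injective _ (two_ne_zero (α := ℂ)) this
  -- By detailed balance the discriminant is `P` conjugated by `diag(√π)`, so `a / √π` is harmonic.
  have h3 : ∀ x, ∑ y, (P x y : ℂ) * (a y / ((√(π y) : ℝ) : ℂ)) = a x / ((√(π x) : ℝ) : ℂ) := by
    intro x
    have hne : ∀ y, ((√(π y) : ℝ) : ℂ) ≠ 0 := fun y =>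
      Complex.ofReal_ne_zero.2 (Real.sqrt_pos.2 (h.pos y)).ne'
    rw [eq_div_iff (hne x), Finset.sum_mul]
    have h4 := congrFun h2 x
    rw [conjTranspose_stepIsometry_mulVec] at h4
    conv_rhs => rw [← h4]
    refine Finset.sum_congr rfl fun y _ => ?_
    rw [swapMatrix_mulVec, stepIsometry_mulVec]
    simp only [Prod.swap]
    have h5 : √(P x y) * √(π x) = √(P y x) * √(π y) := by
      rw [← Real.sqrt_mul (h.ergodic.nonneg _ _), ← Real.sqrt_mul (h.ergodic.nonneg _ _),
        mul_comm, h.detailed_balance, mul_comm]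
    have h6 : P x y = √(P x y) * √(P x y) := (Real.mul_self_sqrt (h.ergodic.nonneg _ _)).symm
    have h7 : ((√(P x y) : ℝ) : ℂ) * ((√(π x) : ℝ) : ℂ) =
        ((√(P y x) : ℝ) : ℂ) * ((√(π y) : ℝ) : ℂ) := by exact_mod_cast h5
    conv_lhs => rw [h6]
    push_cast
    field_simp [hne y]
    linear_combination ((√(P x y) : ℝ) : ℂ) * a y * h7
  have hre : P *ᵥ (fun y => (a y / ((√(π y) : ℝ) : ℂ)).re) =
      fun y => (a y / ((√(π y) : ℝ) : ℂ)).re := by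
    ext x
    rw [← h3 x, Complex.re_sum]
    simp only [Complex.re_ofReal_mul]
    rfl
  have him : P *ᵥ (fun y => (a y / ((√(π y) : ℝ) : ℂ)).im) =
      fun y => (a y / ((√(π y) : ℝ) : ℂ)).im := by
    ext x
    rw [← h3 x, Complex.im_sum]
    simp only [Complex.im_ofReal_mul]
    rfl
  rcases isEmpty_or_nonempty Ω with _ | ⟨⟨x₀⟩⟩
  · exact ⟨0, Subsingleton.elim _ _⟩
  refine ⟨a x₀ / ((√(π x₀) : ℝ) : ℂ), ?_⟩
  ext x
  have : a x / ((√(π x) : ℝ) : ℂ) = a x₀ / ((√(π x₀) : ℝ) : ℂ) :=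
    Complex.ext (h.harmonic_const hre x x₀) (h.harmonic_const him x x₀)
  rw [Pi.smul_apply, smul_eq_mul, ← this, qsample,
    div_mul_cancel₀ _ (Complex.ofReal_ne_zero.2 (Real.sqrt_pos.2 (h.pos x)).ne')]

lemma IsReversibleErgodic.norm_stepIsometry_mulVec (h : IsReversibleErgodic P π) (v : Ω → ℂ) :
    ‖WithLp.toLp 2 (stepIsometry P *ᵥ v)‖ = ‖WithLp.toLp 2 v‖ := by
  rw [norm_eq_sqrt_re_inner (𝕜 := ℂ), norm_eq_sqrt_re_inner (𝕜 := ℂ) (WithLp.toLp 2 v),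
    ← star_dotProduct_eq_inner, ← star_dotProduct_eq_inner, Matrix.star_mulVec,
    ← Matrix.dotProduct_mulVec, Matrix.mulVec_mulVec, h.stepIsometry_isometry, Matrix.one_mulVec]

lemma aeval_mulVec_of_fixed {κ : Type*} [Fintype κ] [DecidableEq κ] {W : Matrix κ κ ℂ} {v : κ → ℂ}
    (hv : W *ᵥ v = v) (Υ : Polynomial ℂ) : Polynomial.aeval W Υ *ᵥ v = Υ.eval 1 • v := by
  induction Υ using Polynomial.induction_on' with
  | add p q hp hq => rw [map_add, Matrix.add_mulVec, hp, hq, Polynomial.eval_add, add_smul]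
  | monomial n a =>
    have hn : W ^ n *ᵥ v = v := by
      induction n with
      | zero => simp
      | succ n ih => rw [pow_succ, ← Matrix.mulVec_mulVec, hv, ih]
    rw [Polynomial.aeval_monomial, ← Matrix.mulVec_mulVec, hn, Algebra.algebraMap_eq_smul_one,
      Matrix.smul_mulVec, Matrix.one_mulVec]
    simp

open scoped Matrix.Norms.L2Operator in
lemma norm_eq_one_of_mem_spectrum {κ : Type*} [Fintype κ] [DecidableEq κ] {W : Matrix κ κ ℂ}
    (hW : W ∈ Matrix.unitaryGroup κ ℂ) {z : ℂ} (hz : z ∈ spectrum ℂ W) : ‖z‖ = 1 := by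
  have := spectrum.subset_circle_of_unitary (𝕜 := ℂ) hW hz
  simpa using this

/-- For `w` fixed by the walk, `⟨w, Tχ⟩ = ⟨T†w, χ⟩` is a multiple of `⟨π|χ⟩ = 0`. So `Tχ` only meets
eigenvalues other than `1`, where the filter is small. -/
lemma GQSP.IsProjector.norm_aeval_walk_le {G : GQSP} {Δ ε : ℝ} (hG : G.IsProjector Δ ε)
    (hε : 0 ≤ ε) (h : IsReversibleErgodic P π) (hΔ : Δ ≤ phaseGap P) {χ : Ω → ℂ}
    (hχ : star (qsample π) ⬝ᵥ χ = 0) :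
    ‖WithLp.toLp 2 (Polynomial.aeval (walk P) G.polynomial *ᵥ (stepIsometry P *ᵥ χ))‖ ≤
      ε * ‖WithLp.toLp 2 χ‖ := by
  rw [← h.norm_stepIsometry_mulVec]
  refine norm_aeval_mulVec_le h.walk_mem_unitary _ hε (fun z hz hz1 => ?_) fun w hw => ?_
  · have hz' : Complex.exp (z.arg * Complex.I) = z := by
      have := Complex.norm_mul_exp_arg_mul_I z
      rwa [norm_eq_one_of_mem_spectrum h.walk_mem_unitary hz, Complex.ofReal_one, one_mul] at this
    have harg : z.arg ≠ 0 := fun h0 => hz1 (by rw [← hz', h0]; simp)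
    -- The principal argument is one of the angles in the infimum, and it lies in the range `|θ| ≤
    -- π` that the filter controls.
    have hle : phaseGap P ≤ |z.arg| :=
      csInf_le ⟨0, by rintro r ⟨θ, -, -, rfl⟩; exact abs_nonneg θ⟩
        ⟨z.arg, harg, by rwa [hz'], rfl⟩
    have := hG.2 z.arg (hΔ.trans hle) (Complex.abs_arg_le_pi z)
    rwa [hz'] at this
  · obtain ⟨c, hc⟩ := h.exists_eq_smul_qsample hw
    have : star w ⬝ᵥ (stepIsometry P *ᵥ χ) = star ((stepIsometry P)ᴴ *ᵥ w) ⬝ᵥ χ := by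
      rw [Matrix.star_mulVec, Matrix.conjTranspose_conjTranspose, ← Matrix.dotProduct_mulVec]
    rw [this, hc, star_smul, smul_dotProduct, hχ, smul_zero]

end FixedSpace

/-! ### Unitaries of circuits -/

lemma ctrlZero_mul {κ : Type u} [Fintype κ] [DecidableEq κ]
    (U V : Matrix κ κ ℂ) : ctrlZero U * ctrlZero V = ctrlZero (U * V) := by
  simp [ctrlZero, add_mul, mul_add, ← Matrix.mul_kronecker_mul]

lemma ctrlZero_one (κ : Type u) [DecidableEq κ] : ctrlZero (1 : Matrix κ κ ℂ) = 1 := by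
  rw [ctrlZero, ← Matrix.add_kronecker, ← Matrix.one_kronecker_one]
  congr 1
  ext i j
  fin_cases i <;> fin_cases j <;> simp [Matrix.single]

lemma one_kronecker_mul_ctrlZero_mul {κ : Type u} [Fintype κ] [DecidableEq κ]
    {A B : Matrix κ κ ℂ} (hAB : A * B = 1) (U : Matrix κ κ ℂ) :
    ((1 : Matrix (Fin 2) (Fin 2) ℂ) ⊗ₖ A) * ctrlZero U * ((1 : Matrix (Fin 2) (Fin 2) ℂ) ⊗ₖ B) =
      ctrlZero (A * U * B) := by
  simp [ctrlZero, add_mul, mul_add, ← Matrix.mul_kronecker_mul, hAB]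

lemma conjTranspose_ctrlZero {κ : Type u} [DecidableEq κ] (U : Matrix κ κ ℂ) :
    (ctrlZero U)ᴴ = ctrlZero Uᴴ := by
  simp [ctrlZero, Matrix.conjTranspose_kronecker]

lemma ctrlZero_mem_unitary {κ : Type u} [Fintype κ] [DecidableEq κ] {U : Matrix κ κ ℂ}
    (hU : U ∈ Matrix.unitaryGroup κ ℂ) : ctrlZero U ∈ Matrix.unitaryGroup (Fin 2 × κ) ℂ := by
  rw [Matrix.mem_unitaryGroup_iff, Matrix.star_eq_conjTranspose, conjTranspose_ctrlZero,
    ctrlZero_mul, ← Matrix.star_eq_conjTranspose, Matrix.mem_unitaryGroup_iff.1 hU, ctrlZero_one]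

lemma conjTranspose_reflection {Ω : Type u} [DecidableEq Ω] (o : Ω) :
    ((1 : Matrix Ω Ω ℂ) ⊗ₖ ((2 : ℂ) • Matrix.single o o (1 : ℂ) - 1))ᴴ =
      (1 : Matrix Ω Ω ℂ) ⊗ₖ ((2 : ℂ) • Matrix.single o o (1 : ℂ) - 1) := by
  simp [Matrix.conjTranspose_kronecker]

section Circuit

variable {ℓ : ℕ} {Ω : Type u} [Fintype Ω] [DecidableEq Ω]
  (O : Fin (ℓ + 1) → Matrix.unitaryGroup (Ω × Ω) ℂ) (o : Ω)

/-- The unitary of a circuit. -/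
def Circuit.toMatrix (c : Circuit ℓ) : Matrix (Fin 2 × Ω × Ω) (Fin 2 × Ω × Ω) ℂ :=
  (c.map (Gate.toMatrix O o)).reverse.prod

lemma Circuit.toMatrix_append (c c' : Circuit ℓ) :
    Circuit.toMatrix O o (c ++ c') = Circuit.toMatrix O o c' * Circuit.toMatrix O o c := by
  simp [Circuit.toMatrix]

lemma Circuit.toMatrix_singleton (g : Gate ℓ) : Circuit.toMatrix O o [g] = g.toMatrix O o := by
  simp [Circuit.toMatrix]

lemma Circuit.run_eq_mulVec (c : Circuit ℓ) (ψ : Fin 2 × Ω × Ω → ℂ) :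
    Circuit.run O o c ψ = Circuit.toMatrix O o c *ᵥ ψ := by
  induction c generalizing ψ with
  | nil => simp [Circuit.run, Circuit.toMatrix]
  | cons g c ih =>
    have h : Circuit.toMatrix O o (g :: c) = Circuit.toMatrix O o c * g.toMatrix O o := by
      simp [Circuit.toMatrix]
    rw [h, ← Matrix.mulVec_mulVec, ← ih]
    rfl

lemma Circuit.run_append (c c' : Circuit ℓ) (ψ : Fin 2 × Ω × Ω → ℂ) :
    Circuit.run O o (c ++ c') ψ = Circuit.run O o c' (Circuit.run O o c ψ) :=
  List.foldl_append

lemma Gate.toMatrix_mem_unitary (g : Gate ℓ) :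
    g.toMatrix O o ∈ Matrix.unitaryGroup (Fin 2 × Ω × Ω) ℂ := by
  cases g with
  | query j => exact Matrix.kronecker_mem_unitary (one_mem _) (O j).2
  | queryAdj j => exact Matrix.kronecker_mem_unitary (one_mem _) (star (O j)).2
  | qubit R => exact Matrix.kronecker_mem_unitary R.2 (one_mem _)
  | ctrlSwap =>
    refine ctrlZero_mem_unitary ?_
    rw [Matrix.mem_unitaryGroup_iff, Matrix.star_eq_conjTranspose, conjTranspose_swapMatrix,
      swapMatrix_mul_self]
  | ctrlReflect =>
    refine ctrlZero_mem_unitary ?_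
    rw [Matrix.mem_unitaryGroup_iff, Matrix.star_eq_conjTranspose, conjTranspose_reflection,
      ← Matrix.mul_kronecker_mul, one_mul, ← Matrix.one_kronecker_one]
    congr 1
    simp only [sub_mul, mul_sub, smul_mul_assoc, mul_smul_comm, Matrix.single_mul_single_same,
      one_mul, mul_one]
    module

lemma Gate.toMatrix_inv (g : Gate ℓ) : g.inv.toMatrix O o = (g.toMatrix O o)ᴴ := by
  cases g <;> simp [Gate.inv, Gate.toMatrix, Matrix.conjTranspose_kronecker,
    conjTranspose_ctrlZero, conjTranspose_swapMatrix, Matrix.star_eq_conjTranspose]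

lemma Circuit.toMatrix_mem_unitary (c : Circuit ℓ) :
    Circuit.toMatrix O o c ∈ Matrix.unitaryGroup (Fin 2 × Ω × Ω) ℂ := by
  refine list_prod_mem fun M hM => ?_
  obtain ⟨g, -, rfl⟩ := List.mem_map.1 (List.mem_reverse.1 hM)
  exact g.toMatrix_mem_unitary O o

lemma Circuit.toMatrix_adjoint (c : Circuit ℓ) :
    Circuit.toMatrix O o (Circuit.adjoint c) = (Circuit.toMatrix O o c)ᴴ := by
  induction c with
  | nil => simp [Circuit.toMatrix, Circuit.adjoint]
  | cons g c ih =>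
    have h1 : Circuit.adjoint (g :: c) = Circuit.adjoint c ++ [g.inv] := by
      simp [Circuit.adjoint]
    have h2 : Circuit.toMatrix O o (g :: c) = Circuit.toMatrix O o c * g.toMatrix O o := by
      simp [Circuit.toMatrix]
    rw [h1, h2, Circuit.toMatrix_append, Circuit.toMatrix_singleton, ih, Gate.toMatrix_inv,
      Matrix.conjTranspose_mul]

end Circuit

/-! ### The unitary of a GQSP circuit -/

/-- A matrix of polynomials evaluated at a signal matrix, as a block matrix. -/
def blockHom {κ : Type u} [Fintype κ] [DecidableEq κ] (W : Matrix κ κ ℂ) :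
    Matrix (Fin 2) (Fin 2) (Polynomial ℂ) →+* Matrix (Fin 2 × κ) (Fin 2 × κ) ℂ :=
  (Matrix.compRingEquiv (Fin 2) κ ℂ).toRingHom.comp
    (Polynomial.aeval W : Polynomial ℂ →ₐ[ℂ] Matrix κ κ ℂ).toRingHom.mapMatrix

lemma blockHom_apply {κ : Type u} [Fintype κ] [DecidableEq κ]
    (W : Matrix κ κ ℂ) (M : Matrix (Fin 2) (Fin 2) (Polynomial ℂ))
    (a b : Fin 2) (x y : κ) : blockHom W M (a, x) (b, y) = Polynomial.aeval W (M a b) x y :=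
  rfl

lemma blockHom_C {κ : Type u} [Fintype κ] [DecidableEq κ]
    (W : Matrix κ κ ℂ) (R : Matrix (Fin 2) (Fin 2) ℂ) :
    blockHom W (R.map Polynomial.C) = R ⊗ₖ (1 : Matrix κ κ ℂ) := by
  ext ⟨a, x⟩ ⟨b, y⟩
  rw [blockHom_apply, Matrix.map_apply, Polynomial.aeval_C, Algebra.algebraMap_eq_smul_one]
  rfl

lemma blockHom_diagonal {κ : Type u} [Fintype κ] [DecidableEq κ] (W : Matrix κ κ ℂ) :
    blockHom W (Matrix.diagonal ![Polynomial.X, 1]) = ctrlZero W := by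
  ext ⟨a, x⟩ ⟨b, y⟩
  rw [blockHom_apply]
  fin_cases a <;> fin_cases b <;> simp [ctrlZero, Matrix.single]

/-- The state `|0⟩ ⊗ w`. -/
def ketZero {κ : Type u} (w : κ → ℂ) : Fin 2 × κ → ℂ := fun z => if z.1 = 0 then w z.2 else 0

lemma ketZero_add {κ : Type u} (v w : κ → ℂ) : ketZero (v + w) = ketZero v + ketZero w := by
  ext ⟨a, x⟩
  fin_cases a <;> simp [ketZero]

lemma ketZero_smul {κ : Type u} (c : ℂ) (w : κ → ℂ) : ketZero (c • w) = c • ketZero w := by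
  ext ⟨a, x⟩
  fin_cases a <;> simp [ketZero]

lemma blockHom_mulVec_ketZero {κ : Type u} [Fintype κ] [DecidableEq κ]
    (W : Matrix κ κ ℂ) (M : Matrix (Fin 2) (Fin 2) (Polynomial ℂ))
    (w : κ → ℂ) (x : κ) :
    (blockHom W M *ᵥ ketZero w) (0, x) = (Polynomial.aeval W (M 0 0) *ᵥ w) x := by
  simp [Matrix.mulVec, dotProduct, Fintype.sum_prod_type, ketZero, blockHom_apply]

lemma one_kronecker_mulVec_ketZero {κ : Type u} [Fintype κ] (A : Matrix κ κ ℂ) (w : κ → ℂ) :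
    ((1 : Matrix (Fin 2) (Fin 2) ℂ) ⊗ₖ A) *ᵥ ketZero w = ketZero (A *ᵥ w) := by
  ext ⟨a, x⟩
  fin_cases a <;> simp [Matrix.mulVec, dotProduct, Fintype.sum_prod_type, ketZero]

lemma star_ketZero_dotProduct {κ : Type u} [Fintype κ] (w : κ → ℂ) (v : Fin 2 × κ → ℂ) :
    star (ketZero w) ⬝ᵥ v = star w ⬝ᵥ fun x => v (0, x) := by
  simp [dotProduct, Fintype.sum_prod_type, ketZero]

lemma norm_ketZero {κ : Type u} [Fintype κ] (w : κ → ℂ) :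
    ‖WithLp.toLp 2 (ketZero w)‖ = ‖WithLp.toLp 2 w‖ := by
  rw [norm_eq_sqrt_re_inner (𝕜 := ℂ), norm_eq_sqrt_re_inner (𝕜 := ℂ) (WithLp.toLp 2 w),
    ← star_dotProduct_eq_inner, ← star_dotProduct_eq_inner, star_ketZero_dotProduct]
  rfl

/-- A unitary whose `|0⟩`-block fixes `w` fixes `|0⟩ ⊗ w`. -/
lemma mulVec_ketZero_of_block_fixed {κ : Type u} [Fintype κ] [DecidableEq κ]
    {U : Matrix (Fin 2 × κ) (Fin 2 × κ) ℂ}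
    (hU : U ∈ Matrix.unitaryGroup (Fin 2 × κ) ℂ) {w : κ → ℂ}
    (hw : (fun x => (U *ᵥ ketZero w) (0, x)) = w) : U *ᵥ ketZero w = ketZero w := by
  have h := norm_sub_sq (𝕜 := ℂ) (WithLp.toLp 2 (ketZero w)) (WithLp.toLp 2 (U *ᵥ ketZero w))
  rw [← star_dotProduct_eq_inner, star_ketZero_dotProduct, hw, star_dotProduct_eq_inner,
    inner_self_eq_norm_sq, norm_toLp_mulVec hU, norm_ketZero] at h
  -- The inner product of the two vectors equals the squared norm of each, the equality case of
  -- Cauchy–Schwarz.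
  have h0 : ‖WithLp.toLp 2 (ketZero w) - WithLp.toLp 2 (U *ᵥ ketZero w)‖ = 0 := by nlinarith
  rw [norm_eq_zero, sub_eq_zero] at h0
  exact (WithLp.toLp_injective 2 h0).symm

lemma phaseGate_kronecker_mulVec {κ : Type u} [Fintype κ] [DecidableEq κ]
    (φ : ℝ) (v : Fin 2 × κ → ℂ) :
    ((phaseGate φ : Matrix (Fin 2) (Fin 2) ℂ) ⊗ₖ (1 : Matrix κ κ ℂ)) *ᵥ v =
      v + (Complex.exp (φ * Complex.I) - 1) • ketZero fun x => v (0, x) := by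
  ext ⟨a, x⟩
  have h : ∀ a x, (((phaseGate φ : Matrix (Fin 2) (Fin 2) ℂ) ⊗ₖ (1 : Matrix κ κ ℂ)) *ᵥ v) (a, x) =
      (![Complex.exp (φ * Complex.I), 1] : Fin 2 → ℂ) a * v (a, x) := fun a x => by
    simp [phaseGate, Matrix.mulVec, dotProduct, Fintype.sum_prod_type, Matrix.diagonal_apply,
      Matrix.one_apply]
  rw [h]
  fin_cases a
  · simp [ketZero]; ring
  · simp [ketZero]

/-! ### The compiled selective phase -/

section Compiler

variable {ℓ : ℕ} {Ω : Type u} [Fintype Ω] [DecidableEq Ω]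
  {O : Fin (ℓ + 1) → Matrix.unitaryGroup (Ω × Ω) ℂ} {o : Ω} {j : Fin (ℓ + 1)}
  {P : Matrix Ω Ω ℝ} {π : Ω → ℝ}

/-- The isometry `|x⟩ ↦ |x⟩|o⟩`. -/
def refIsometry {Ω : Type u} [DecidableEq Ω] (o : Ω) : Matrix (Ω × Ω) Ω ℂ :=
  Matrix.of fun z x => if z = (x, o) then 1 else 0

lemma refIsometry_mul_conjTranspose (o : Ω) :
    refIsometry o * (refIsometry o)ᴴ = (1 : Matrix Ω Ω ℂ) ⊗ₖ Matrix.single o o (1 : ℂ) := by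
  ext ⟨a, b⟩ ⟨c, d⟩
  by_cases hb : b = o <;> by_cases hd : d = o <;> by_cases hac : a = c <;>
    simp [refIsometry, Matrix.mul_apply, @eq_comm _ o,
      @eq_comm _ c, hb, hd, hac, apply_ite]

lemma conjTranspose_refIsometry_mul (o : Ω) : (refIsometry o)ᴴ * refIsometry o = 1 := by
  ext x y
  simp [refIsometry, Matrix.mul_apply, Matrix.one_apply, eq_comm]

lemma cleanState_eq_ketZero (π : Ω → ℝ) (o : Ω) :
    cleanState π o = ketZero (refIsometry o *ᵥ qsample π) := by
  ext ⟨a, x, y⟩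
  by_cases ha : a = 0 <;> by_cases hy : y = o <;>
    simp [cleanState, ketZero, refIsometry, Matrix.mulVec, dotProduct, ha, hy]

lemma IsOracle.mul_refIsometry {U : Matrix.unitaryGroup (Ω × Ω) ℂ} (hU : IsOracle P o U) :
    (U : Matrix (Ω × Ω) (Ω × Ω) ℂ) * refIsometry o = stepIsometry P := by
  ext z x
  rw [← hU x z]
  simp [refIsometry, Matrix.mul_apply]

lemma IsOracle.conjTranspose_mul_stepIsometry {U : Matrix.unitaryGroup (Ω × Ω) ℂ}
    (hU : IsOracle P o U) :
    (U : Matrix (Ω × Ω) (Ω × Ω) ℂ)ᴴ * stepIsometry P = refIsometry o := by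
  rw [← hU.mul_refIsometry, ← Matrix.mul_assoc, ← Matrix.star_eq_conjTranspose,
    Matrix.mem_unitaryGroup_iff'.1 U.2, Matrix.one_mul]

lemma toMatrix_ctrlWalk (hO : IsOracle P o (O j)) :
    Circuit.toMatrix O o (ctrlWalk j) = ctrlZero (walk P) := by
  set U : Matrix (Ω × Ω) (Ω × Ω) ℂ := (O j : Matrix (Ω × Ω) (Ω × Ω) ℂ) with hU
  have hUU : U * Uᴴ = 1 := Matrix.mem_unitaryGroup_iff.1 (O j).2
  have h0 : (1 : Matrix Ω Ω ℂ) ⊗ₖ ((2 : ℂ) • Matrix.single o o (1 : ℂ) - 1) =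
      (2 : ℂ) • (refIsometry o * (refIsometry o)ᴴ) - 1 := by
    rw [refIsometry_mul_conjTranspose]
    refine eq_sub_of_add_eq ?_
    rw [← Matrix.one_kronecker_one, ← Matrix.kronecker_add, sub_add_cancel, Matrix.kronecker_smul]
  have h1 : U * ((1 : Matrix Ω Ω ℂ) ⊗ₖ ((2 : ℂ) • Matrix.single o o (1 : ℂ) - 1)) * Uᴴ =
      (2 : ℂ) • (stepIsometry P * (stepIsometry P)ᴴ) - 1 := by
    rw [← hO.mul_refIsometry, h0, Matrix.conjTranspose_mul, mul_sub, sub_mul, mul_one, hUU]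
    simp only [Matrix.mul_smul, Matrix.smul_mul, Matrix.mul_assoc, ← hU]
  have h2 : Circuit.toMatrix O o (ctrlWalk j) = ((1 : Matrix (Fin 2) (Fin 2) ℂ) ⊗ₖ U) *
      ctrlZero ((1 : Matrix Ω Ω ℂ) ⊗ₖ ((2 : ℂ) • Matrix.single o o (1 : ℂ) - 1)) *
      ((1 : Matrix (Fin 2) (Fin 2) ℂ) ⊗ₖ Uᴴ) * ctrlZero (swapMatrix Ω) := by
    simp [Circuit.toMatrix, ctrlWalk, Gate.toMatrix, ← hU, mul_assoc]
  rw [h2, one_kronecker_mul_ctrlZero_mul hUU, h1, ctrlZero_mul, walk]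

lemma toMatrix_gqsp_circuit (hO : IsOracle P o (O j)) (G : GQSP) :
    Circuit.toMatrix O o (G.circuit j) = blockHom (walk P) G.polyMatrix := by
  obtain ⟨R, l⟩ := G
  induction l using List.reverseRecOn with
  | nil =>
    have h1 : GQSP.polyMatrix ⟨R, []⟩ = (R : Matrix (Fin 2) (Fin 2) ℂ).map Polynomial.C := rfl
    have h2 : GQSP.circuit ⟨R, []⟩ j = [Gate.qubit R] := rfl
    rw [h1, h2, blockHom_C, Circuit.toMatrix_singleton]
    rfl
  | append_singleton l R' ih =>
    have h2 : GQSP.circuit ⟨R, l ++ [R']⟩ j =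
        GQSP.circuit ⟨R, l⟩ j ++ ctrlWalk j ++ [Gate.qubit R'] := by
      simp [GQSP.circuit]
    rw [h2, Circuit.toMatrix_append, Circuit.toMatrix_append, ih, toMatrix_ctrlWalk hO,
      Circuit.toMatrix_singleton, GQSP.polyMatrix_append, map_mul, map_mul, blockHom_C,
      blockHom_diagonal, mul_assoc]
    rfl

/-- On a clean state, the compiled selective phase is close to the ideal one. -/
theorem norm_run_selectivePhaseCircuit_sub_le {G : GQSP} {Δ ε : ℝ} (hG : G.IsProjector Δ ε)
    (hε : 0 ≤ ε) (h : IsReversibleErgodic P π) (hΔ : Δ ≤ phaseGap P) (hO : IsOracle P o (O j))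
    (φ : ℝ) {χ : Ω → ℂ} (hχ : star χ ⬝ᵥ χ = 1) :
    ‖WithLp.toLp 2 (Circuit.run O o (selectivePhaseCircuit G j φ) (ketZero (refIsometry o *ᵥ χ)) -
      ketZero (refIsometry o *ᵥ (selectivePhase (qsample π) φ *ᵥ χ)))‖ ≤ 2 * ε := by
  set T := stepIsometry P with hT
  set V := Circuit.toMatrix O o (G.circuit j) with hV
  have hVu : V ∈ Matrix.unitaryGroup _ ℂ := Circuit.toMatrix_mem_unitary O o _
  set U : Matrix (Ω × Ω) (Ω × Ω) ℂ := (O j : Matrix (Ω × Ω) (Ω × Ω) ℂ) with hU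
  set Υ := Polynomial.aeval (walk P) G.polynomial with hΥ
  set ω := Complex.exp (φ * Complex.I) - 1 with hω
  set c := star (qsample π) ⬝ᵥ χ with hc
  set χ' := χ - c • qsample π with hχ'
  have hVV : ∀ v, Vᴴ *ᵥ (V *ᵥ v) = v := fun v => by
    rw [Matrix.mulVec_mulVec, ← Matrix.star_eq_conjTranspose, Matrix.mem_unitaryGroup_iff'.1 hVu,
      Matrix.one_mulVec]
  have hVΥ : ∀ w, (fun x => (V *ᵥ ketZero w) (0, x)) = Υ *ᵥ w := fun w => by
    ext x
    rw [hV, toMatrix_gqsp_circuit hO, blockHom_mulVec_ketZero]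
    rfl
  have hfix : Υ *ᵥ (T *ᵥ qsample π) = T *ᵥ qsample π := by
    rw [hΥ, aeval_mulVec_of_fixed h.walk_mulVec_qsample, hG.1, one_smul]
  have hVfix : V *ᵥ ketZero (T *ᵥ qsample π) = ketZero (T *ᵥ qsample π) :=
    mulVec_ketZero_of_block_fixed hVu (by rw [hVΥ, hfix])
  have hVfix' : Vᴴ *ᵥ ketZero (T *ᵥ qsample π) = ketZero (T *ᵥ qsample π) := by
    conv_lhs => rw [← hVfix, hVV]
  -- `V† P_φ V = 1 + ω V† (|0⟩⟨0| ⊗ 1) V`, and the `|0⟩`-block of `V` is `Υ(W)`.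
  have hrun : Circuit.run O o (selectivePhaseCircuit G j φ) (ketZero (refIsometry o *ᵥ χ)) =
      ((1 : Matrix (Fin 2) (Fin 2) ℂ) ⊗ₖ Uᴴ) *ᵥ
        (ketZero (T *ᵥ χ) + ω • (Vᴴ *ᵥ ketZero (Υ *ᵥ (T *ᵥ χ)))) := by
    have e1 : (Gate.query j : Gate ℓ).toMatrix O o = (1 : Matrix (Fin 2) (Fin 2) ℂ) ⊗ₖ U := rfl
    have e2 : (Gate.queryAdj j : Gate ℓ).toMatrix O o = (1 : Matrix (Fin 2) (Fin 2) ℂ) ⊗ₖ Uᴴ := rfl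
    have e3 : (Gate.qubit (phaseGate φ) : Gate ℓ).toMatrix O o =
      (phaseGate φ : Matrix (Fin 2) (Fin 2) ℂ) ⊗ₖ (1 : Matrix (Ω × Ω) (Ω × Ω) ℂ) := rfl
    rw [Circuit.run_eq_mulVec, selectivePhaseCircuit]
    simp only [Circuit.toMatrix_append, Circuit.toMatrix_singleton, Circuit.toMatrix_adjoint,
      ← Matrix.mulVec_mulVec, e1, e2, e3, ← hV]
    rw [one_kronecker_mulVec_ketZero, Matrix.mulVec_mulVec _ U, hO.mul_refIsometry,
      phaseGate_kronecker_mulVec, Matrix.mulVec_add, hVV, Matrix.mulVec_smul, hVΥ]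
  -- The ideal output has the same shape with `χ` replaced by its component along `|π⟩` inside
  -- `Υ(W)`, so the error is `ω V† |0⟩ Υ(W) T χ'` up to a unitary.
  have htarget : ketZero (refIsometry o *ᵥ (selectivePhase (qsample π) φ *ᵥ χ)) =
      ((1 : Matrix (Fin 2) (Fin 2) ℂ) ⊗ₖ Uᴴ) *ᵥ
        (ketZero (T *ᵥ χ) + ω • (Vᴴ *ᵥ ketZero (Υ *ᵥ (T *ᵥ (c • qsample π))))) := by
    rw [Matrix.mulVec_smul, Matrix.mulVec_smul, hfix, ketZero_smul, Matrix.mulVec_smul, hVfix',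
      ← hO.conjTranspose_mul_stepIsometry, ← Matrix.mulVec_mulVec, ← one_kronecker_mulVec_ketZero,
      selectivePhase_mulVec, Matrix.mulVec_add, Matrix.mulVec_smul, ketZero_add, ketZero_smul,
      smul_smul]
  have hdiff : ketZero (Υ *ᵥ (T *ᵥ χ)) - ketZero (Υ *ᵥ (T *ᵥ (c • qsample π))) =
      ketZero (Υ *ᵥ (T *ᵥ χ')) := by
    rw [sub_eq_iff_eq_add, ← ketZero_add, ← Matrix.mulVec_add, ← Matrix.mulVec_add, hχ',
      sub_add_cancel]
  have hUu : ((1 : Matrix (Fin 2) (Fin 2) ℂ) ⊗ₖ Uᴴ) ∈ Matrix.unitaryGroup (Fin 2 × Ω × Ω) ℂ :=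
    Gate.toMatrix_mem_unitary O o (Gate.queryAdj j)
  have hVu' : Vᴴ ∈ Matrix.unitaryGroup (Fin 2 × Ω × Ω) ℂ := Unitary.star_mem hVu
  rw [hrun, htarget, ← Matrix.mulVec_sub, norm_toLp_mulVec hUu, add_sub_add_left_eq_sub,
    ← smul_sub, ← Matrix.mulVec_sub, hdiff, WithLp.toLp_smul, norm_smul, norm_toLp_mulVec hVu',
    norm_ketZero]
  have hω2 : ‖ω‖ ≤ 2 := by
    refine (norm_sub_le _ _).trans ?_
    rw [Complex.norm_exp_ofReal_mul_I, norm_one]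
    norm_num
  have horth : star (qsample π) ⬝ᵥ χ' = 0 := by
    rw [hχ', dotProduct_sub, dotProduct_smul, h.qsample_unit, ← hc]
    simp
  have hχ'1 : ‖WithLp.toLp 2 χ'‖ ≤ 1 := by
    have := traceDist_eq_norm_sub_smul hχ h.qsample_unit
    rw [← hc, ← WithLp.toLp_smul, ← WithLp.toLp_sub, ← hχ', traceDist] at this
    rw [← this, Real.sqrt_le_one]
    exact sub_le_self _ (sq_nonneg _)
  have hmain := hG.norm_aeval_walk_le hε h hΔ horth
  exact mul_le_mul hω2 (hmain.trans (mul_le_of_le_one_right hε hχ'1)) (norm_nonneg _) zero_le_two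

end Compiler

/-! ### Error accumulation over phases and stages -/

section Algorithm

variable {ℓ : ℕ} {Ω : Type u} [Fintype Ω] [DecidableEq Ω]
  {O : Fin (ℓ + 1) → Matrix.unitaryGroup (Ω × Ω) ℂ} {o : Ω}

lemma star_clean_dotProduct (χ ξ : Ω → ℂ) :
    star (ketZero (refIsometry o *ᵥ χ)) ⬝ᵥ ketZero (refIsometry o *ᵥ ξ) = star χ ⬝ᵥ ξ := by
  have h : star (ketZero (refIsometry o *ᵥ χ)) ⬝ᵥ ketZero (refIsometry o *ᵥ ξ) =
      star (refIsometry o *ᵥ χ) ⬝ᵥ (refIsometry o *ᵥ ξ) := star_ketZero_dotProduct _ _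
  rw [h, Matrix.star_mulVec, ← Matrix.dotProduct_mulVec, Matrix.mulVec_mulVec,
    conjTranspose_refIsometry_mul, Matrix.one_mulVec]

lemma norm_run_sub_le_add {c c' : Circuit ℓ} {u v w : Fin 2 × Ω × Ω → ℂ} {a b : ℝ}
    (h : ‖WithLp.toLp 2 (Circuit.run O o c u - v)‖ ≤ a)
    (h' : ‖WithLp.toLp 2 (Circuit.run O o c' v - w)‖ ≤ b) :
    ‖WithLp.toLp 2 (Circuit.run O o (c ++ c') u - w)‖ ≤ a + b := by
  have e : Circuit.run O o (c ++ c') u - w =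
      Circuit.toMatrix O o c' *ᵥ (Circuit.run O o c u - v) + (Circuit.run O o c' v - w) := by
    rw [Circuit.run_append, Circuit.run_eq_mulVec O o c', Circuit.run_eq_mulVec O o c' v,
      Matrix.mulVec_sub]
    abel
  rw [e, WithLp.toLp_add]
  refine (norm_add_le _ _).trans (add_le_add ?_ h')
  rwa [norm_toLp_mulVec (Circuit.toMatrix_mem_unitary O o c')]

variable {Ps Pt : Matrix Ω Ω ℝ} {πs πt : Ω → ℝ} {i : Fin ℓ}

/-- Each pair costs two compiled phases of error `2ε`. Ideal phases map clean states to clean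
states, so the compiler bound applies again at every step. -/
lemma norm_run_stage_sub_le {L : List (ℝ × ℝ)} {Gs Gt : GQSP} {Δs Δt ε : ℝ}
    (hGs : Gs.IsProjector Δs ε) (hGt : Gt.IsProjector Δt ε) (hε : 0 ≤ ε)
    (hs : IsReversibleErgodic Ps πs) (ht : IsReversibleErgodic Pt πt)
    (hΔs : Δs ≤ phaseGap Ps) (hΔt : Δt ≤ phaseGap Pt)
    (hOs : IsOracle Ps o (O i.castSucc)) (hOt : IsOracle Pt o (O i.succ))
    {χ : Ω → ℂ} (hχ : star χ ⬝ᵥ χ = 1) :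
    ‖WithLp.toLp 2 (Circuit.run O o (L.flatMap fun a => selectivePhaseCircuit Gs i.castSucc a.1 ++
        selectivePhaseCircuit Gt i.succ a.2) (ketZero (refIsometry o *ᵥ χ)) -
      ketZero (refIsometry o *ᵥ (amplifier L (qsample πs) (qsample πt) *ᵥ χ)))‖ ≤
      L.length * (4 * ε) := by
  induction L generalizing χ with
  | nil => simp [Circuit.run, amplifier]
  | cons a L ih =>
    have hu1 := selectivePhase_mem_unitary hs.qsample_unit a.1
    have hu2 := selectivePhase_mem_unitary ht.qsample_unit a.2
    have hχ1 : star (selectivePhase (qsample πs) a.1 *ᵥ χ) ⬝ᵥ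
        (selectivePhase (qsample πs) a.1 *ᵥ χ) = 1 := by
      rw [star_dotProduct_mulVec_self hu1, hχ]
    have hχ2 := (star_dotProduct_mulVec_self hu2 (selectivePhase (qsample πs) a.1 *ᵥ χ)
      (selectivePhase (qsample πs) a.1 *ᵥ χ)).trans hχ1
    have h1 := norm_run_selectivePhaseCircuit_sub_le hGs hε hs hΔs hOs a.1 hχ
    have h2 := norm_run_selectivePhaseCircuit_sub_le hGt hε ht hΔt hOt a.2 hχ1
    have h3 := norm_run_sub_le_add (norm_run_sub_le_add h1 h2) (ih hχ2)
    rw [List.flatMap_cons, amplifier_cons, ← Matrix.mulVec_mulVec, ← Matrix.mulVec_mulVec,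
      List.length_cons]
    refine h3.trans (le_of_eq ?_)
    push_cast
    ring

lemma cleanState_unit {P : Matrix Ω Ω ℝ} {π : Ω → ℝ} (h : IsReversibleErgodic P π) (o : Ω) :
    star (cleanState π o) ⬝ᵥ cleanState π o = 1 := by
  rw [cleanState_eq_ketZero, star_clean_dotProduct, h.qsample_unit]

lemma run_unit (c : Circuit ℓ) {v : Fin 2 × Ω × Ω → ℂ} (hv : star v ⬝ᵥ v = 1) :
    star (Circuit.run O o c v) ⬝ᵥ Circuit.run O o c v = 1 := by
  rw [Circuit.run_eq_mulVec, star_dotProduct_mulVec_self (Circuit.toMatrix_mem_unitary O o c), hv]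

theorem Stage.IsAdmissible.traceDist_le {A : Stage} {p Δs Δt ε : ℝ}
    (hA : Stage.IsAdmissible.{u} A ℓ p Δs Δt ε)
    (hs : IsReversibleErgodic Ps πs) (ht : IsReversibleErgodic Pt πt)
    (hΔs : Δs ≤ phaseGap Ps) (hΔt : Δt ≤ phaseGap Pt)
    (hp : p ≤ ‖star (qsample πs) ⬝ᵥ qsample πt‖ ^ 2)
    (hOs : IsOracle Ps o (O i.castSucc)) (hOt : IsOracle Pt o (O i.succ)) :
    traceDist (Circuit.run O o (A.circuit i) (cleanState πs o)) (cleanState πt o) ≤ ε / ℓ := by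
  set χ := amplifier A.phases (qsample πs) (qsample πt) *ᵥ qsample πs with hχ
  have hχ1 : star χ ⬝ᵥ χ = 1 := by
    rw [hχ, star_dotProduct_mulVec_self (amplifier_mem_unitary _ hs.qsample_unit ht.qsample_unit),
      hs.qsample_unit]
  have hclean : star (ketZero (refIsometry o *ᵥ χ)) ⬝ᵥ ketZero (refIsometry o *ᵥ χ) = 1 := by
    rw [star_clean_dotProduct, hχ1]
  have h1 := norm_run_stage_sub_le (L := A.phases) hA.source_projector hA.target_projector
    hA.εW_mem.1.le hs ht hΔs hΔt hOs hOt hs.qsample_unit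
  rw [← cleanState_eq_ketZero, ← hχ] at h1
  have h2 := traceDist_le_norm_sub (run_unit (O := O) (o := o) (A.circuit i)
    (cleanState_unit hs o)) hclean
  have h3 : traceDist (ketZero (refIsometry o *ᵥ χ)) (cleanState πt o) ≤ A.εFP := by
    rw [traceDist, cleanState_eq_ketZero, star_clean_dotProduct]
    exact hA.fixedPoint Ω _ _ hs.qsample_unit ht.qsample_unit hp
  have h4 := traceDist_triangle (run_unit (O := O) (o := o) (A.circuit i)
    (cleanState_unit hs o)) hclean (cleanState_unit ht o)
  have h5 := hA.error_le
  rw [Stage.L] at h5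
  push_cast at h5
  have h6 := h2.trans h1
  linarith

/-- Hybrid argument: replace the output of the first stage by its target; the remaining unitary
circuit preserves the trace distance between the two. -/
lemma traceDist_run_flatMap_le {n : ℕ} (f : Fin n → Circuit ℓ)
    (v : Fin (n + 1) → Fin 2 × Ω × Ω → ℂ) (hv : ∀ k, star (v k) ⬝ᵥ v k = 1) {η : ℝ}
    (h : ∀ k : Fin n, traceDist (Circuit.run O o (f k) (v k.castSucc)) (v k.succ) ≤ η) :
    traceDist (Circuit.run O o ((List.finRange n).flatMap f) (v 0)) (v (Fin.last n)) ≤ n * η := by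
  induction n with
  | zero => simp [Circuit.run, traceDist, hv]
  | succ n ih =>
    have h1 := ih (fun k => f k.succ) (fun k => v k.succ) (fun k => hv k.succ) fun k => h k.succ
    have h2 := h 0
    rw [List.finRange_succ, List.flatMap_cons, List.flatMap_map, Circuit.run_append]
    set c : Circuit ℓ := (List.finRange n).flatMap fun k => f k.succ
    have h3 : traceDist (Circuit.run O o c (Circuit.run O o (f 0) (v 0)))
        (Circuit.run O o c (v (Fin.succ 0))) ≤ η := by
      rw [Circuit.run_eq_mulVec O o c, Circuit.run_eq_mulVec O o c,
        traceDist_mulVec (Circuit.toMatrix_mem_unitary O o c)]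
      exact h2
    have h4 := traceDist_triangle (run_unit (O := O) (o := o) c (run_unit (O := O) (o := o) (f 0)
      (hv 0))) (run_unit (O := O) (o := o) c (hv (Fin.succ 0))) (hv (Fin.last (n + 1)))
    push_cast
    refine h4.trans ?_
    rw [Fin.succ_last] at h1
    linarith

end Algorithm

end QSamplePrep

end

/-! ### The main theorem -/

theorem mainTheorem1 :
    ∃ C : ℝ, 0 < C ∧
      ∀ (ℓ : ℕ) (p : Fin ℓ → ℝ) (Δ : Fin (ℓ + 1) → ℝ) (pmin Δmin ε : ℝ),
        (∀ i, 0 < p i ∧ p i ≤ 1) →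
        (∀ j, 0 < Δ j ∧ Δ j ≤ 2 * Real.pi) →
        IsLeast (Set.range p) pmin →
        IsLeast (Set.range Δ) Δmin →
        0 < ε → ε < 1 →
        (∃ A : Fin ℓ → QSamplePrep.Stage,
          QSamplePrep.IsAdmissible.{u} A p Δ ε ∧
          ((QSamplePrep.algorithm A).queries : ℝ) ≤
            C * QSamplePrep.queryBound ℓ pmin Δmin (min ε (1 / 2))) ∧
        (∀ A : Fin ℓ → QSamplePrep.Stage,
          QSamplePrep.IsAdmissible.{u} A p Δ ε →
          ∀ (Ω : Type u) [Fintype Ω] [DecidableEq Ω] (o : Ω)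
            (P : Fin (ℓ + 1) → Matrix Ω Ω ℝ) (π : Fin (ℓ + 1) → Ω → ℝ)
            (O : Fin (ℓ + 1) → Matrix.unitaryGroup (Ω × Ω) ℂ),
            (∀ j, QSamplePrep.IsReversibleErgodic (P j) (π j)) →
            (∀ j, Δ j ≤ QSamplePrep.phaseGap (P j)) →
            (∀ i : Fin ℓ, p i ≤
              ‖star (QSamplePrep.qsample (π i.castSucc)) ⬝ᵥ
                QSamplePrep.qsample (π i.succ)‖ ^ 2) →
            (∀ j, QSamplePrep.IsOracle (P j) o (O j)) →
            QSamplePrep.traceDist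
                ((QSamplePrep.algorithm A).run O o (QSamplePrep.cleanState (π 0) o))
                (QSamplePrep.cleanState (π (Fin.last ℓ)) o) ≤ ε) := by
  obtain ⟨C, hC, h⟩ := QSamplePrep.exists_admissible_data.{u}
  refine ⟨C, hC, fun ℓ p Δ pmin Δmin ε hp hΔ hpmin hΔmin hε hε1 =>
    ⟨h ℓ p Δ pmin Δmin ε hp hΔ hpmin hΔmin hε hε1, fun A hA Ω _ _ o P π O hP hgap hov hO => ?_⟩⟩
  -- A least overlap bound exists only if there is at least one stage.
  have hℓ : (ℓ : ℝ) ≠ 0 := by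
    obtain ⟨⟨i, -⟩, -⟩ := hpmin
    exact_mod_cast i.pos.ne'
  have := QSamplePrep.traceDist_run_flatMap_le (O := O) (o := o) (fun i => (A i).circuit i)
    (fun j => QSamplePrep.cleanState (π j) o)
    (fun j => QSamplePrep.cleanState_unit (hP j) o) (η := ε / ℓ)
    fun i => (hA i).traceDist_le (hP _) (hP _) (hgap _) (hgap _) (hov i) (hO _) (hO _)
  rwa [mul_div_cancel₀ _ hℓ] at this
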